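/- Let $k$ be a field of characteristic zero and let $B$ be an affine $k$-domain, i.e. a commutative $k$-algebra which is an integral domain and finitely generated over $k$. A \emph{fundamental pair} for $B$ is a pair $(D,U)$ of locally nilpotent $k$-derivations of $B$ such that $[D,[D,U]]=-2D$, $[U,[D,U]]=2U$ and $B=\sum_{d\in\mathbb Z}B_d$, where $B_d=\ker([D,U]-d\,\mathrm{id})$; it is \emph{nontrivial} unless $D=U=0$. Let $(D,U)$ be a nontrivial fundamental pair for $B$, and let $B=\bigoplus_{d\in\mathbb Z}B_d$ be the induced $\mathbb Z$-grading. Let $A=\ker D$, $\Omega=\ker U$, and $A_n=A\cap B_n$ for $n\in\mathbb Z$. For $n\ge 0$ let $\mathcal F_n=\ker D^{n+1}$ (an $A$-module) and $I_n=D^n(\mathcal F_n)$ (an ideal of $A$). Then: (a) $A$ is a finitely generated $k$-algebra. (b) $I_n=\bigoplus_{i\ge n}A_i$ for each $n\ge 0$. In particular $A_i=0$ for $i<0$ and $A=\bigoplus_{i\in\mathbb N}A_i$ is $\mathbb N$-graded. (c) Let $f_1,\dots,f_r\in A$ be homogeneous with $I_1=(f_1,\dots,f_r)$ as an ideal of $A$.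 Then some $f_i$ is nonzero, and the maximum $m$ of the degrees of the nonzero $f_i$ is a non-negative integer. Moreover: (i) $A=A_0[f_1,\dots,f_r]$; (ii) for every $n\ge 1$, the ideal $I_n$ of $A$ is generated by $A_n\cup A_{n+1}\cup\dots\cup A_{n+m-1}$; (iii) for every $n>m$, $I_n=\sum_{e\in E}I_1^{e_1}I_2^{e_2}\cdots I_m^{e_m}$, where $E=\{(e_1,\dots,e_m)\in\mathbb N^m \mid \sum_i i\,e_i=n\}$. (d) Let $n\ge 1$, let $g_1,\dots,g_s\in A$ be homogeneous with $I_n=(g_1,\dots,g_s)$, and set $h_i=U^ng_i$ for $1\le i\le s$. Then $\mathcal F_n=Ah_1+\dots+Ah_s+\mathcal F_{n-1}$. (e) $B=\Omega\oplus DB=A\oplus UB$ as $A_0$-modules. (f) $D$ maps $B_n$ into $B_{n+2}$ for every $n\in\mathbb Z$, and $D:B_n\to B_{n+2}$ is injective if $n\le -1$ and surjective if $n\ge -1$. (g) $DB_{-2}=UB_2$, and $B_0=A_0\oplus DB_{-2}$ as $A_0$-modules. -/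

import Mathlib

/-! Derivations of a commutative `k`-algebra `B`, fundamental pairs, and the objects attached to
them: the induced grading, the kernel, the degree modules and the image ideals. -/

namespace FundPair

section

variable {k B : Type*} [Field k] [CommRing B] [Algebra k B]

/-- `D` is locally nilpotent: every element is killed by some power of `D`. -/
def IsLocallyNilpotent (D : Derivation k B B) : Prop :=
  ∀ b : B, ∃ n : ℕ, D^[n] b = 0

/-- `B_d`, the kernel of the `k`-linear operator `[D, U] - d I` on `B`. -/
def piece (D U : Derivation k B B) (d : ℤ) : Submodule k B :=
  LinearMap.ker ((⁅D, U⁆ : Derivation k B B).toLinearMap - d • (LinearMap.id : B →ₗ[k] B))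

/-- A pair `(D, U)` of locally nilpotent derivations is a fundamental pair if
`[D, [D, U]] = -2 D`, `[U, [D, U]] = 2 U` and `B` is the sum of the subspaces `B_d`, `d ∈ ℤ`. -/
structure IsFundamentalPair (D U : Derivation k B B) : Prop where
  locallyNilpotent_left : IsLocallyNilpotent D
  locallyNilpotent_right : IsLocallyNilpotent U
  lie_left : ⁅D, ⁅D, U⁆⁆ = (-2 : ℤ) • D
  lie_right : ⁅U, ⁅D, U⁆⁆ = (2 : ℤ) • U
  sum_pieces : ⨆ d : ℤ, piece D U d = ⊤

/-- The pair `(D, U)` is nontrivial, i.e. not `D = U = 0`. -/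
def IsNontrivialPair (D U : Derivation k B B) : Prop := ¬ (D = 0 ∧ U = 0)

/-- The kernel of a derivation, a `k`-subalgebra of `B`. -/
def kernel (D : Derivation k B B) : Subalgebra k B where
  carrier := {b | D b = 0}
  mul_mem' := by
    intro a b ha hb
    change D _ = 0 at ha hb ⊢
    simp [ha, hb]
  add_mem' := by
    intro a b ha hb
    change D _ = 0 at ha hb ⊢
    simp [ha, hb]
  algebraMap_mem' := by
    intro c
    simp

theorem mem_kernel {D : Derivation k B B} {b : B} : b ∈ kernel D ↔ D b = 0 := Iff.rfl

theorem mem_piece {D U : Derivation k B B} {d : ℤ} {b : B} :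
    b ∈ piece D U d ↔ ⁅D, U⁆ b = d • b := by
  rw [piece, LinearMap.mem_ker, LinearMap.sub_apply, sub_eq_zero]
  rfl

/-- `A_d = A ∩ B_d` with `A = ker D`, as a subspace of `A`. -/
def kernelPiece (D U : Derivation k B B) (d : ℤ) : Submodule k (kernel D) :=
  (piece D U d).comap (kernel D).val.toLinearMap

/-- The `k`-subalgebra `A_0 = A ∩ B_0` of `B`. -/
def kernelZero (D U : Derivation k B B) : Subalgebra k B where
  carrier := {b | b ∈ kernel D ∧ b ∈ piece D U 0}
  mul_mem' := by
    rintro a b ⟨ha, ha'⟩ ⟨hb, hb'⟩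
    refine ⟨mul_mem ha hb, ?_⟩
    rw [mem_piece] at *
    rw [Derivation.leibniz, ha', hb']
    simp
  add_mem' := by
    rintro a b ⟨ha, ha'⟩ ⟨hb, hb'⟩
    exact ⟨add_mem ha hb, add_mem ha' hb'⟩
  algebraMap_mem' := by
    intro c
    refine ⟨(kernel D).algebraMap_mem c, ?_⟩
    rw [mem_piece]
    simp

/-- `D` as a linear operator over its kernel. -/
def kernelLinear (D : Derivation k B B) : B →ₗ[kernel D] B where
  toFun := D
  map_add' := D.map_add
  map_smul' := by
    intro a b
    have ha : D (a : B) = 0 := a.2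
    simp [Subalgebra.smul_def, ha]

/-- The degree module `F_n = ker D^(n+1)`, a module over `A = ker D`. -/
def degreeModule (D : Derivation k B B) (n : ℕ) : Submodule (kernel D) B :=
  LinearMap.ker (kernelLinear D ^ (n + 1))

/-- The image ideal `I_n = D^n (F_n)`, an ideal of `A = ker D`
(note that `D^n (F_n)` is contained in `A`). -/
def imageIdeal (D : Derivation k B B) (n : ℕ) : Ideal (kernel D) :=
  ((degreeModule D n).map (kernelLinear D ^ n)).comap (Algebra.linearMap (kernel D) B)

theorem mem_degreeModule {D : Derivation k B B} {n : ℕ} {b : B} :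
    b ∈ degreeModule D n ↔ D^[n + 1] b = 0 := by
  rw [degreeModule, LinearMap.mem_ker, Module.End.pow_apply]
  rfl

theorem mem_imageIdeal {D : Derivation k B B} {n : ℕ} {a : kernel D} :
    a ∈ imageIdeal D n ↔ ∃ b, D^[n + 1] b = 0 ∧ D^[n] b = (a : B) := by
  simp only [imageIdeal, Submodule.mem_comap, Submodule.mem_map, mem_degreeModule,
    Module.End.pow_apply]
  rfl

end

/-- `S = P ⊕ Q` as `R`-modules, for subsets `S`, `P`, `Q` of an `R`-module `M`: all three are
`R`-submodules, and `S` is the internal direct sum of `P` and `Q`. -/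
def IsDirectSumOver (R : Type*) {M : Type*} [CommRing R] [AddCommGroup M] [Module R M]
    (S P Q : Set M) : Prop :=
  ∃ s p q : Submodule R M, (s : Set M) = S ∧ (p : Set M) = P ∧ (q : Set M) = Q ∧
    Disjoint p q ∧ p ⊔ q = s

end FundPair

/-! The relations make `B` a representation of sl₂ with raising operator `D` (degree +2), lowering
operator `U` (degree -2) and weight spaces `B_d`. Both operators are locally nilpotent, so in
characteristic zero the theory of finite-dimensional representations is available by hand. `A = ker
D` consists of sums of highest weight vectors, and `A_0` consists of invariants.

Everything rests on the commutation of `D` with `U ^ j` (`left_iterate_right`). It shows that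
highest weights are nonnegative and that vectors of weight `d ≥ 0` are combinations of the `U^j a`
with `a` a highest weight vector (`kernel_induction_of_nonneg`). Hence `D` maps onto `B_d` for `d ≥
1`, and `B_d = A_d + U B_{d+2}`. An eigenvalue argument gives `ker D ∩ im U = 0` (`right_eq_zero`).
Parts (e), (f) and (g) follow.

For (b), a homogeneous `a ∈ A` of degree at least `n` is a nonzero multiple of `D^n (U^n a)`.
Conversely, a component of `D^n b` of degree less than `n` lies in `ker D ∩ im U`, hence vanishes.
Once `I_n` is known to be the part of `A` of degree at least `n`, (c) and (d) are inductions on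
degree with homogeneous coefficients.

For (a), `B` is an equivariant quotient of a polynomial ring `S` on finitely many ladders of
variables. The invariants of `S[x, y]`, where `x, y` span the standard representation, are finitely
generated by Hilbert's argument (`fg_of_reynolds`, `exists_reynolds`). The substitution `x = 0`, `y
= 1` followed by `S → B` maps them onto `ker D` (`exists_kernel_lift`, `exists_invariant`). -/

namespace FundPair

/-! ### Weight spaces and highest weight theory for the sl₂-action of `D` and `U`. -/

section Weights

variable {k B : Type*} [Field k] [CommRing B] [Algebra k B] {D U : Derivation k B B}

theorem mem_piece_iff_smul {d : ℤ} {b : B} :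
    b ∈ piece D U d ↔ D (U b) - U (D b) = (d : k) • b := by
  rw [mem_piece, Derivation.commutator_apply, Int.cast_smul_eq_zsmul]

theorem piece_eq_eigenspace (d : ℤ) :
    piece D U d = Module.End.eigenspace (⁅D, U⁆ : Derivation k B B).toLinearMap (d : k) := by
  ext b
  rw [mem_piece, Module.End.mem_eigenspace_iff, Int.cast_smul_eq_zsmul]
  rfl

theorem mul_mem_piece {d e : ℤ} {a b : B} (ha : a ∈ piece D U d) (hb : b ∈ piece D U e) :
    a * b ∈ piece D U (d + e) := by
  rw [mem_piece] at *
  rw [Derivation.leibniz, ha, hb, add_smul, smul_eq_mul, smul_eq_mul, mul_smul_comm,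
    mul_smul_comm, mul_comm b a, add_comm]

theorem one_mem_piece : (1 : B) ∈ piece D U 0 := by
  rw [mem_piece]; simp

theorem pow_mem_piece {d : ℤ} {x : B} (hx : x ∈ piece D U d) (n : ℕ) :
    x ^ n ∈ piece D U (n * d) := by
  induction n with
  | zero => simpa using one_mem_piece
  | succ n ih =>
    rw [pow_succ]
    convert mul_mem_piece ih hx using 1
    push_cast
    ring_nf

theorem piece_swap (D U : Derivation k B B) (d : ℤ) : piece U D d = piece D U (-d) := by
  ext b
  rw [mem_piece_iff_smul, mem_piece_iff_smul, ← neg_inj]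
  simp

theorem iSupIndep_piece [CharZero k] : iSupIndep (piece D U) := by
  have h := Module.End.eigenspaces_iSupIndep (⁅D, U⁆ : Derivation k B B).toLinearMap
  have h2 := h.comp (f := fun d : ℤ => (d : k)) Int.cast_injective
  convert h2 using 1
  funext d
  exact piece_eq_eigenspace d

theorem iterate_smul (D : Derivation k B B) (j : ℕ) (c : k) (b : B) :
    D^[j] (c • b) = c • D^[j] b := by
  induction j with
  | zero => rfl
  | succ j ih => rw [Function.iterate_succ_apply', ih, Derivation.map_smul,
      Function.iterate_succ_apply']

/-- The scalar by which `D ^ j ∘ U ^ j` acts on the elements of `ker D` of degree `d`. -/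
def ladder (k : Type*) [Field k] (d : ℤ) (j : ℕ) : k :=
  ∏ i ∈ Finset.range j, (((i + 1) * (d - i) : ℤ) : k)

theorem ladder_ne_zero [CharZero k] {d : ℤ} {j : ℕ} (hj : (j : ℤ) ≤ d) : ladder k d j ≠ 0 := by
  rw [ladder, Finset.prod_ne_zero_iff]
  intro i hi
  rw [Finset.mem_range] at hi
  rw [Int.cast_ne_zero]
  exact mul_ne_zero (by omega) (by omega)

namespace IsFundamentalPair

/-- Exchanging `D` and `U` negates the grading, so every statement about one operator has a mirror
image for the other. -/
theorem symm (h : IsFundamentalPair D U) : IsFundamentalPair U D where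
  locallyNilpotent_left := h.locallyNilpotent_right
  locallyNilpotent_right := h.locallyNilpotent_left
  lie_left := by
    rw [← lie_skew U D, lie_neg, h.lie_right, neg_smul]
  lie_right := by
    rw [← lie_skew U D, lie_neg, h.lie_left, neg_smul, neg_neg]
  sum_pieces := by
    rw [← top_le_iff, ← h.sum_pieces]
    refine iSup_le fun d => le_iSup_of_le (-d) ?_
    rw [piece_swap D U, neg_neg]

theorem map_left_mem (h : IsFundamentalPair D U) {d : ℤ} {b : B} (hb : b ∈ piece D U d) :
    D b ∈ piece D U (d + 2) := by
  have h1 := congrArg (fun E : Derivation k B B => E b) h.lie_left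
  simp only [Derivation.commutator_apply (D1 := D) (D2 := ⁅D, U⁆), Derivation.coe_smul,
    Pi.smul_apply] at h1
  rw [mem_piece] at *
  rw [hb, map_zsmul] at h1
  rw [add_smul, ← sub_eq_zero]
  linear_combination (exp := 1) -h1 + (by module : (-2 : ℤ) • D b + (2 : ℤ) • D b = 0)

theorem map_right_mem (h : IsFundamentalPair D U) {d : ℤ} {b : B} (hb : b ∈ piece D U d) :
    U b ∈ piece D U (d - 2) := by
  have := h.symm.map_left_mem (d := -d) (b := b) (by rwa [piece_swap, neg_neg])
  rw [piece_swap] at this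
  convert this using 1
  ring_nf

theorem iterate_left_mem (h : IsFundamentalPair D U) {d : ℤ} {b : B} (hb : b ∈ piece D U d)
    (j : ℕ) : D^[j] b ∈ piece D U (d + 2 * j) := by
  induction j with
  | zero => simpa using hb
  | succ j ih =>
    rw [Function.iterate_succ_apply']
    convert h.map_left_mem ih using 1
    push_cast; ring_nf

theorem iterate_right_mem (h : IsFundamentalPair D U) {d : ℤ} {b : B} (hb : b ∈ piece D U d)
    (j : ℕ) : U^[j] b ∈ piece D U (d - 2 * j) := by
  induction j with
  | zero => simpa using hb
  | succ j ih =>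
    rw [Function.iterate_succ_apply']
    convert h.map_right_mem ih using 1
    push_cast; ring_nf

theorem left_iterate_right (h : IsFundamentalPair D U) {d : ℤ} {b : B} (hb : b ∈ piece D U d)
    (j : ℕ) : D (U^[j + 1] b) =
      U^[j + 1] (D b) + (((j + 1) * (d - j) : ℤ) : k) • U^[j] b := by
  induction j with
  | zero =>
    have := mem_piece_iff_smul.1 hb
    simp only [zero_add, Function.iterate_one, Function.iterate_zero, id]
    push_cast
    rw [sub_eq_iff_eq_add] at this
    rw [this]; module
  | succ j ih =>
    have h1 := mem_piece_iff_smul.1 (h.iterate_right_mem hb (j + 1))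
    rw [sub_eq_iff_eq_add, ih, map_add, Derivation.map_smul] at h1
    rw [Function.iterate_succ_apply' U (j + 1) b, h1, Function.iterate_succ_apply' U (j + 1) (D b),
      Function.iterate_succ_apply' U j b]
    push_cast
    module

theorem iterate_left_right (h : IsFundamentalPair D U) {d : ℤ} {b : B} (hb : b ∈ piece D U d)
    (j : ℕ) : D^[j + 1] (U b) =
      U (D^[j + 1] b) + (((j + 1) * (d + j) : ℤ) : k) • D^[j] b := by
  have := h.symm.left_iterate_right (d := -d) (b := b) (by rwa [piece_swap, neg_neg]) j
  rw [this]
  push_cast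
  module

theorem left_iterate_right_of_kernel (h : IsFundamentalPair D U) {d : ℤ} {a : B}
    (ha : a ∈ piece D U d) (ha' : D a = 0) (j : ℕ) :
    D (U^[j + 1] a) = (((j + 1) * (d - j) : ℤ) : k) • U^[j] a := by
  rw [h.left_iterate_right ha, ha', iterate_map_zero, zero_add]

theorem iterate_left_iterate_right_of_kernel (h : IsFundamentalPair D U) {d : ℤ} {a : B}
    (ha : a ∈ piece D U d) (ha' : D a = 0) (j : ℕ) :
    D^[j] (U^[j] a) = ladder k d j • a := by
  induction j with
  | zero => simp [ladder]
  | succ j ih =>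
    rw [Function.iterate_succ_apply, h.left_iterate_right_of_kernel ha ha',
      iterate_smul, ih, smul_smul, ladder, ladder, Finset.prod_range_succ, mul_comm]

@[elab_as_elim]
theorem induction_piece (h : IsFundamentalPair D U) {P : B → Prop}
    (zero : P 0) (add : ∀ a b, P a → P b → P (a + b))
    (piece : ∀ d, ∀ b ∈ piece D U d, P b) (b : B) : P b :=
  Submodule.iSup_induction (FundPair.piece D U) (motive := P)
    (by rw [h.sum_pieces]; trivial) piece zero add

section CharZero

variable [CharZero k]

/-- If `N` is the last exponent with `U^N a ≠ 0`, then `0 = D (U^(N+1) a) = (N+1)(d-N) U^N a`, which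
forces `d = N`. -/
theorem nonneg_of_kernel (h : IsFundamentalPair D U) {d : ℤ} {a : B}
    (ha : a ∈ piece D U d) (ha' : D a = 0) (hne : a ≠ 0) : 0 ≤ d := by
  classical
  have hex := h.locallyNilpotent_right a
  have hN := Nat.find_spec hex
  obtain ⟨N, hNe⟩ : ∃ N, Nat.find hex = N + 1 :=
    Nat.exists_eq_succ_of_ne_zero fun h0 => hne (by simpa [h0] using hN)
  have hlt : U^[N] a ≠ 0 := Nat.find_min hex (by omega)
  rw [hNe] at hN
  have := h.left_iterate_right_of_kernel ha ha' N
  rw [hN, map_zero, eq_comm, smul_eq_zero, or_iff_left hlt, Int.cast_eq_zero,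
    mul_eq_zero] at this
  omega

theorem eq_zero_of_kernel_of_neg (h : IsFundamentalPair D U) {d : ℤ} {a : B}
    (ha : a ∈ piece D U d) (ha' : D a = 0) (hd : d < 0) : a = 0 := by
  by_contra hne
  exact absurd (h.nonneg_of_kernel ha ha' hne) (by omega)

/-- A form of complete reducibility: the vectors `U^j a`, with `a ∈ ker D` of weight `d + 2j`, span
`B_d`. When `D^(N+1) b = 0`, the vector `a = D^N b` is a highest weight vector, and subtracting a
multiple of `U^N a` from `b` lowers the nilpotency order. The multiple exists because the ladder
scalar is nonzero, and this is where `0 ≤ d` enters. -/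
theorem kernel_induction_of_nonneg (h : IsFundamentalPair D U) {d : ℤ} (hd : 0 ≤ d)
    (P : Submodule k B)
    (hP : ∀ (j : ℕ) (a : B), a ∈ piece D U (d + 2 * j) → D a = 0 → U^[j] a ∈ P)
    {b : B} (hb : b ∈ piece D U d) : b ∈ P := by
  obtain ⟨N, hN⟩ := h.locallyNilpotent_left b
  induction N generalizing b with
  | zero => simp_all
  | succ N ih =>
    have ha := h.iterate_left_mem hb N
    have ha' : D (D^[N] b) = 0 := by rwa [← Function.iterate_succ_apply' D]
    have hl : ladder k (d + 2 * N) N ≠ 0 := ladder_ne_zero (by omega)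
    set a := D^[N] b with hadef
    have key : b - (ladder k (d + 2 * N) N)⁻¹ • U^[N] a ∈ P := by
      apply ih
      · refine sub_mem hb (Submodule.smul_mem _ _ ?_)
        convert h.iterate_right_mem ha N using 1
        ring_nf
      · rw [iterate_map_sub, iterate_smul, h.iterate_left_iterate_right_of_kernel ha ha',
          smul_smul, inv_mul_cancel₀ hl, one_smul, hadef, sub_self]
    have := add_mem key (P.smul_mem (ladder k (d + 2 * N) N)⁻¹ (hP N a ha ha'))
    rwa [sub_add_cancel] at this

theorem exists_left_eq (h : IsFundamentalPair D U) {d : ℤ} (hd : 1 ≤ d) {b : B}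
    (hb : b ∈ piece D U d) : ∃ c ∈ piece D U (d - 2), D c = b := by
  refine h.kernel_induction_of_nonneg (by omega : 0 ≤ d)
    ((piece D U (d - 2)).map D.toLinearMap) (fun j a ha ha' => ?_) hb
  have hne : ((((j : ℤ) + 1) * (d + 2 * j - j) : ℤ) : k) ≠ 0 := by
    rw [Int.cast_ne_zero]
    exact mul_ne_zero (by omega) (by omega)
  refine ⟨_, Submodule.smul_mem _ (((((j : ℤ) + 1) * (d + 2 * j - j) : ℤ) : k))⁻¹
    (?_ : U^[j + 1] a ∈ _), ?_⟩
  · convert h.iterate_right_mem ha (j + 1) using 1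
    push_cast; ring_nf
  · rw [map_smul]
    change _ • D (U^[j + 1] a) = _
    rw [h.left_iterate_right_of_kernel ha ha', smul_smul, inv_mul_cancel₀ hne, one_smul]

theorem exists_right_eq (h : IsFundamentalPair D U) {d : ℤ} (hd : d ≤ -1) {b : B}
    (hb : b ∈ piece D U d) : ∃ c ∈ piece D U (d + 2), U c = b := by
  obtain ⟨c, hc, hcb⟩ := h.symm.exists_left_eq (d := -d) (by omega)
    (b := b) (by rwa [piece_swap, neg_neg])
  refine ⟨c, ?_, hcb⟩
  rw [piece_swap] at hc
  convert hc using 1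
  ring_nf

theorem exists_kernel_add_right (h : IsFundamentalPair D U) (d : ℤ) {b : B}
    (hb : b ∈ piece D U d) :
    ∃ a ∈ piece D U d, D a = 0 ∧ ∃ c ∈ piece D U (d + 2), a + U c = b := by
  rcases lt_or_ge d 0 with hd | hd
  · obtain ⟨c, hc, hcb⟩ := h.exists_right_eq (by omega : d ≤ -1) hb
    exact ⟨0, zero_mem _, map_zero _, c, hc, by rw [hcb, zero_add]⟩
  · have := h.kernel_induction_of_nonneg hd
      ((piece D U d ⊓ LinearMap.ker D.toLinearMap) ⊔ (piece D U (d + 2)).map U.toLinearMap)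
      (fun j a ha ha' => ?_) hb
    · obtain ⟨a, ⟨ha, ha'⟩, _, ⟨c, hc, rfl⟩, hac⟩ := Submodule.mem_sup.1 this
      exact ⟨a, ha, ha', c, hc, hac⟩
    · cases j with
      | zero => exact Submodule.mem_sup_left ⟨by simpa using ha, ha'⟩
      | succ j =>
        refine Submodule.mem_sup_right ⟨U^[j] a, ?_, (Function.iterate_succ_apply' U j a).symm⟩
        have := h.iterate_right_mem ha j
        rwa [show d + 2 * ((j + 1 : ℕ) : ℤ) - 2 * j = d + 2 by push_cast; ring] at this

/-- `U ∘ D` has no negative integer eigenvalue in weight `w ≥ 0`. Passing from `b` to `D b` replaces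
the eigenvalue `-(l+1)` by `-(l+1) - (w+2)`, again negative, so induction on the nilpotency order
gives `D b = 0`; then `(l+1) b = 0`. -/
theorem eq_zero_of_right_left (h : IsFundamentalPair D U) (N : ℕ) (w l : ℕ) {b : B}
    (hb : b ∈ piece D U w) (hN : D^[N] b = 0) (hl : U (D b) = (-((l : k) + 1)) • b) : b = 0 := by
  induction N generalizing w l b with
  | zero => simpa using hN
  | succ N ih =>
    have hDb := h.map_left_mem hb
    have h1 := mem_piece_iff_smul.1 hDb
    have hD0 : D b = 0 := by
      refine ih (w + 2) (l + w + 2) (by exact_mod_cast hDb) hN ?_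
      rw [hl, Derivation.map_smul, sub_eq_iff_eq_add, ← sub_eq_iff_eq_add'] at h1
      rw [← h1]
      push_cast
      module
    rw [hD0, map_zero, eq_comm, smul_eq_zero, neg_eq_zero] at hl
    exact hl.resolve_left (by exact_mod_cast Nat.succ_ne_zero l)

theorem right_eq_zero_of_homogeneous (h : IsFundamentalPair D U) {d : ℤ} {b : B}
    (hb : b ∈ piece D U (d + 2)) (hDU : D (U b) = 0) : U b = 0 := by
  by_contra hne
  have hU : U b ∈ piece D U d := by simpa using h.map_right_mem hb
  obtain ⟨n, rfl⟩ := Int.eq_ofNat_of_zero_le (h.nonneg_of_kernel hU hDU hne)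
  obtain ⟨N, hN⟩ := h.locallyNilpotent_left b
  have h1 := mem_piece_iff_smul.1 hb
  apply hne
  -- Since `D (U b) = 0` and `b` has weight `n + 2`, the commutator gives `U (D b) = -(n + 2) b`.
  rw [h.eq_zero_of_right_left N (n + 2) (n + 1) (by exact_mod_cast hb) hN ?_, map_zero]
  rw [hDU, zero_sub] at h1
  rw [← neg_inj, h1]
  push_cast
  module

/-- Write `b = U b₁`, possible in negative weight, and move `U` to the left past `D^(n+1)`. The
correction is a multiple of `D^n b₁`: either its scalar vanishes, or the inequality still holds for
`b₁` and induction applies. -/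
theorem iterate_left_mem_range_right (h : IsFundamentalPair D U) (n : ℕ) {d : ℤ}
    (hd : d + n < 0) {b : B} (hb : b ∈ piece D U d) :
    ∃ c ∈ piece D U (d + 2 * n + 2), U c = D^[n] b := by
  induction n generalizing d b with
  | zero => simpa using h.exists_right_eq (by omega) hb
  | succ n ih =>
    obtain ⟨b₁, hb₁, rfl⟩ := h.exists_right_eq (by omega : d ≤ -1) hb
    rw [h.iterate_left_right hb₁]
    have h1 := h.iterate_left_mem hb₁ (n + 1)
    rcases eq_or_ne (d + 2 + n) 0 with h0 | h0
    · refine ⟨D^[n + 1] b₁, ?_, by rw [h0]; simp⟩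
      convert h1 using 1
      push_cast; ring_nf
    · obtain ⟨c, hc, hcb⟩ := ih (d := d + 2) (by push_cast at hd; omega) hb₁
      refine ⟨D^[n + 1] b₁ + (((n + 1) * (d + 2 + n) : ℤ) : k) • c,
        add_mem ?_ (Submodule.smul_mem _ _ ?_), by rw [map_add, Derivation.map_smul, hcb]⟩
      · convert h1 using 1
        push_cast; ring_nf
      · convert hc using 1
        push_cast; ring_nf

/-! ### Homogeneous components, and the reduction of statements on `B` to homogeneous elements. -/

theorem isInternal_piece (h : IsFundamentalPair D U) : DirectSum.IsInternal (piece D U) :=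
  DirectSum.isInternal_submodule_of_iSupIndep_of_iSup_eq_top iSupIndep_piece h.sum_pieces

/-- The projection of `B` onto its homogeneous component of degree `d`. -/
noncomputable def component (h : IsFundamentalPair D U) (d : ℤ) : B →ₗ[k] B :=
  (piece D U d).subtype ∘ₗ DirectSum.component k ℤ (fun i => piece D U i) d ∘ₗ
    (LinearEquiv.ofBijective (DirectSum.coeLinearMap (piece D U)) h.isInternal_piece).symm

theorem component_mem (h : IsFundamentalPair D U) (d : ℤ) (b : B) :
    h.component d b ∈ piece D U d := Submodule.coe_mem _

theorem component_apply_of_mem (h : IsFundamentalPair D U) {e : ℤ} {b : B}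
    (hb : b ∈ piece D U e) (d : ℤ) : h.component d b = if e = d then b else 0 := by
  have : (LinearEquiv.ofBijective (DirectSum.coeLinearMap (piece D U)) h.isInternal_piece).symm b
      = DirectSum.lof k ℤ (fun i => piece D U i) e ⟨b, hb⟩ := by
    rw [LinearEquiv.symm_apply_eq]
    exact (DirectSum.coeLinearMap_lof (piece D U) e ⟨b, hb⟩).symm
  simp only [component, LinearMap.comp_apply, LinearEquiv.coe_coe, this, DirectSum.component.of]
  split_ifs with hed
  · subst hed; rfl
  · rfl

theorem component_same (h : IsFundamentalPair D U) {d : ℤ} {b : B}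
    (hb : b ∈ piece D U d) : h.component d b = b := by
  rw [h.component_apply_of_mem hb, if_pos rfl]

theorem eq_zero_of_component (h : IsFundamentalPair D U) {b : B}
    (hb : ∀ d, h.component d b = 0) : b = 0 := by
  have : (LinearEquiv.ofBijective (DirectSum.coeLinearMap (piece D U)) h.isInternal_piece).symm b
      = 0 := by
    refine DFinsupp.ext fun d => Subtype.ext (hb d)
  simpa using this

theorem mem_of_component (h : IsFundamentalPair D U) (P : Submodule k B) {b : B}
    (hb : ∀ d, h.component d b ∈ P) : b ∈ P := by
  classical
  set e := LinearEquiv.ofBijective (DirectSum.coeLinearMap (piece D U)) h.isInternal_piece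
  have h1 : b = DirectSum.coeLinearMap (piece D U) (e.symm b) := (e.apply_symm_apply b).symm
  rw [h1, DirectSum.coeLinearMap_eq_dfinsuppSum, DFinsupp.sum]
  exact sum_mem fun d _ => hb d

theorem component_left (h : IsFundamentalPair D U) (d : ℤ) (b : B) :
    h.component (d + 2) (D b) = D (h.component d b) := by
  refine h.induction_piece (P := fun b => h.component (d + 2) (D b) = D (h.component d b))
    (by simp) (fun a b ha hb => by simp [ha, hb]) (fun e b hb => ?_) b
  rw [h.component_apply_of_mem hb, h.component_apply_of_mem (h.map_left_mem hb)]
  by_cases hed : e = d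
  · simp [hed]
  · simp [hed]

theorem component_right (h : IsFundamentalPair D U) (d : ℤ) (b : B) :
    h.component d (U b) = U (h.component (d + 2) b) := by
  refine h.induction_piece (P := fun b => h.component d (U b) = U (h.component (d + 2) b))
    (by simp) (fun a b ha hb => by simp [ha, hb]) (fun e b hb => ?_) b
  rw [h.component_apply_of_mem hb, h.component_apply_of_mem (h.map_right_mem hb)]
  by_cases hed : e = d + 2
  · simp [hed]
  · rw [if_neg hed, if_neg (by omega), map_zero]

theorem component_iterate_left (h : IsFundamentalPair D U) (n : ℕ) (d : ℤ) (b : B) :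
    h.component (d + 2 * n) (D^[n] b) = D^[n] (h.component d b) := by
  induction n with
  | zero => simp
  | succ n ih =>
    rw [Function.iterate_succ_apply', Function.iterate_succ_apply', ← ih, ← h.component_left]
    push_cast; ring_nf

theorem component_mul_right (h : IsFundamentalPair D U) {e : ℤ} {f : B}
    (hf : f ∈ piece D U e) (d : ℤ) (b : B) :
    h.component (d + e) (b * f) = h.component d b * f := by
  refine h.induction_piece (P := fun b => h.component (d + e) (b * f) = h.component d b * f)
    (by simp) (fun a b ha hb => by simp [ha, hb, add_mul]) (fun i b hb => ?_) b
  rw [h.component_apply_of_mem hb, h.component_apply_of_mem (mul_mem_piece hb hf)]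
  by_cases hed : i = d
  · simp [hed]
  · simp [hed]

theorem left_component_of_kernel (h : IsFundamentalPair D U) {a : B} (ha : D a = 0) (d : ℤ) :
    D (h.component d a) = 0 := by
  rw [← h.component_left, ha, map_zero]

/-- This says `ker D ∩ im U = 0`, the source of all the directness statements below. -/
theorem right_eq_zero (h : IsFundamentalPair D U) {b : B} (hDU : D (U b) = 0) : U b = 0 := by
  refine h.eq_zero_of_component fun d => ?_
  rw [h.component_right]
  apply h.right_eq_zero_of_homogeneous (h.component_mem _ _)
  rw [← h.component_right]
  exact h.left_component_of_kernel hDU d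

theorem exists_kernel_add (h : IsFundamentalPair D U) (b : B) :
    ∃ a c, D a = 0 ∧ a + U c = b := by
  have : b ∈ LinearMap.ker D.toLinearMap ⊔ LinearMap.range U.toLinearMap := by
    refine h.mem_of_component _ fun d => ?_
    obtain ⟨a, _, ha, c, _, hac⟩ := h.exists_kernel_add_right d (h.component_mem d b)
    rw [← hac]
    exact Submodule.add_mem_sup ha ⟨c, rfl⟩
  obtain ⟨a, ha, _, ⟨c, rfl⟩, hac⟩ := Submodule.mem_sup.1 this
  exact ⟨a, c, ha, hac⟩

end CharZero

end IsFundamentalPair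

end Weights

/-! ### The image ideals `I_n` as the parts of `A` of degree at least `n`. -/

section ImageIdeals

variable {k B : Type*} [Field k] [CommRing B] [Algebra k B] {D U : Derivation k B B}

theorem mem_kernelPiece {d : ℤ} {a : kernel D} :
    a ∈ kernelPiece D U d ↔ (a : B) ∈ piece D U d := Iff.rfl

theorem mul_mem_kernelPiece {d e : ℤ} {a b : kernel D} (ha : a ∈ kernelPiece D U d)
    (hb : b ∈ kernelPiece D U e) : a * b ∈ kernelPiece D U (d + e) :=
  mul_mem_piece ha hb

theorem imageIdeal_zero : imageIdeal D 0 = ⊤ := by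
  ext a
  simp only [mem_imageIdeal, Submodule.mem_top, iff_true]
  exact ⟨a, a.2, rfl⟩

namespace IsFundamentalPair

variable [CharZero k]

/-- The homogeneous component of degree `d` of an element of `ker D`. -/
noncomputable def kernelComponent (h : IsFundamentalPair D U) (d : ℤ) :
    kernel D →ₗ[k] kernel D where
  toFun a := ⟨h.component d a, h.left_component_of_kernel a.2 d⟩
  map_add' a b := Subtype.ext (by simp)
  map_smul' c a := Subtype.ext (by simp)

theorem coe_kernelComponent (h : IsFundamentalPair D U) (d : ℤ) (a : kernel D) :
    (h.kernelComponent d a : B) = h.component d a := rfl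

theorem kernelComponent_mem (h : IsFundamentalPair D U) (d : ℤ) (a : kernel D) :
    h.kernelComponent d a ∈ kernelPiece D U d := h.component_mem d a

theorem kernelComponent_of_mem (h : IsFundamentalPair D U) {e : ℤ} {a : kernel D}
    (ha : a ∈ kernelPiece D U e) (d : ℤ) :
    h.kernelComponent d a = if e = d then a else 0 := by
  apply Subtype.ext
  rw [coe_kernelComponent, h.component_apply_of_mem (mem_kernelPiece.1 ha)]
  split_ifs <;> rfl

theorem kernelPiece_of_neg (h : IsFundamentalPair D U) {d : ℤ} (hd : d < 0) :
    kernelPiece D U d = ⊥ := by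
  rw [eq_bot_iff]
  intro a ha
  exact Subtype.ext (h.eq_zero_of_kernel_of_neg ha a.2 hd)

theorem degree_unique (h : IsFundamentalPair D U) {d e : ℤ} {a : kernel D} (ha : a ≠ 0)
    (hd : a ∈ kernelPiece D U d) (he : a ∈ kernelPiece D U e) : d = e := by
  by_contra hne
  have h1 := h.kernelComponent_of_mem hd e
  rw [h.kernelComponent_of_mem he, if_pos rfl, if_neg hne] at h1
  exact ha h1

theorem mem_of_kernelComponent (h : IsFundamentalPair D U) (P : Submodule k (kernel D))
    {a : kernel D} (ha : ∀ n : ℕ, h.kernelComponent n a ∈ P) : a ∈ P := by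
  have : (a : B) ∈ P.map (kernel D).val.toLinearMap := by
    refine h.mem_of_component _ fun d => ?_
    refine ⟨h.kernelComponent d a, ?_, rfl⟩
    rcases lt_or_ge d 0 with hd | hd
    · have := h.kernelComponent_mem d a
      rw [h.kernelPiece_of_neg hd, Submodule.mem_bot] at this
      simp [this]
    · obtain ⟨n, rfl⟩ := Int.eq_ofNat_of_zero_le hd
      exact ha n
  obtain ⟨b, hb, hba⟩ := this
  rwa [← Subtype.ext (a1 := b) (a2 := a) hba]

theorem mem_imageIdeal_of_mem_kernelPiece (h : IsFundamentalPair D U) {n : ℕ} {d : ℤ}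
    (hd : n ≤ d) {a : kernel D} (ha : a ∈ kernelPiece D U d) : a ∈ imageIdeal D n := by
  rw [mem_imageIdeal]
  have h1 : D^[n] ((ladder k d n)⁻¹ • U^[n] (a : B)) = a := by
    rw [iterate_smul, h.iterate_left_iterate_right_of_kernel (mem_kernelPiece.1 ha) a.2, smul_smul,
      inv_mul_cancel₀ (ladder_ne_zero hd), one_smul]
  exact ⟨_, by rw [Function.iterate_succ_apply', h1]; exact a.2, h1⟩

/-- If `a = D^n b`, its component of degree `d` is `D^n` of the component of `b` of degree `d - 2n`.
As `(d - 2n) + n < 0`, it lies in `im U`; it also lies in `ker D`, hence is zero. -/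
theorem kernelComponent_eq_zero_of_mem_imageIdeal (h : IsFundamentalPair D U) {n : ℕ}
    {a : kernel D} (ha : a ∈ imageIdeal D n) {d : ℤ} (hd : d < n) :
    h.kernelComponent d a = 0 := by
  obtain ⟨b, -, hba⟩ := mem_imageIdeal.1 ha
  apply Subtype.ext
  have h1 := h.component_iterate_left n (d - 2 * n) b
  obtain ⟨c, -, hc⟩ := h.iterate_left_mem_range_right n (d := d - 2 * n) (by omega)
    (h.component_mem (d - 2 * n) b)
  rw [hba, sub_add_cancel, ← hc] at h1
  rw [coe_kernelComponent, h1, ZeroMemClass.coe_zero]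
  apply h.right_eq_zero
  rw [← h1]
  exact h.left_component_of_kernel a.2 d

theorem le_degree_of_mem_imageIdeal (h : IsFundamentalPair D U) {n : ℕ} {d : ℤ} {a : kernel D}
    (ha : a ∈ imageIdeal D n) (had : a ∈ kernelPiece D U d) (hne : a ≠ 0) : n ≤ d := by
  by_contra! hlt
  have := h.kernelComponent_eq_zero_of_mem_imageIdeal ha hlt
  rw [h.kernelComponent_of_mem had, if_pos rfl] at this
  exact hne this

theorem imageIdeal_le_of_kernelPiece (h : IsFundamentalPair D U) {n : ℕ}
    (P : Submodule k (kernel D)) (hP : ∀ i : ℕ, n ≤ i → kernelPiece D U i ≤ P) :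
    (imageIdeal D n).restrictScalars k ≤ P := by
  intro a ha
  refine h.mem_of_kernelComponent P fun i => ?_
  rcases lt_or_ge i n with hi | hi
  · rw [h.kernelComponent_eq_zero_of_mem_imageIdeal ha (by exact_mod_cast hi)]
    exact zero_mem _
  · exact hP i hi (h.kernelComponent_mem i a)

theorem imageIdeal_eq_iSup (h : IsFundamentalPair D U) (n : ℕ) :
    (imageIdeal D n).restrictScalars k = ⨆ i : ℕ, ⨆ _ : n ≤ i, kernelPiece D U i := by
  apply le_antisymm
  · exact h.imageIdeal_le_of_kernelPiece _ fun i hi => le_iSup₂_of_le i hi le_rfl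
  · exact iSup₂_le fun i hi a ha =>
      h.mem_imageIdeal_of_mem_kernelPiece (by exact_mod_cast hi) ha

theorem imageIdeal_le_ideal (h : IsFundamentalPair D U) {n : ℕ} (J : Ideal (kernel D))
    (hJ : ∀ i : ℕ, n ≤ i → ∀ a ∈ kernelPiece D U i, a ∈ J) : imageIdeal D n ≤ J :=
  h.imageIdeal_le_of_kernelPiece (J.restrictScalars k) hJ

theorem imageIdeal_mul_le (h : IsFundamentalPair D U) (i j : ℕ) :
    imageIdeal D i * imageIdeal D j ≤ imageIdeal D (i + j) := by
  rw [← Submodule.le_div_iff_mul_le]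
  refine h.imageIdeal_le_ideal _ fun s hs a ha => ?_
  rw [Submodule.mem_div_iff_forall_mul_mem]
  intro b hb
  have : imageIdeal D j ≤
      Submodule.comap (LinearMap.mulLeft (kernel D) a) (imageIdeal D (i + j)) := by
    refine h.imageIdeal_le_ideal _ fun t ht b hb => ?_
    exact h.mem_imageIdeal_of_mem_kernelPiece (d := s + t) (by push_cast; omega)
      (mul_mem_kernelPiece ha hb)
  exact this hb

omit [CharZero k] in
theorem gradedMonoid_kernelPiece :
    SetLike.GradedMonoid (fun i : ℕ => kernelPiece D U i) where
  one_mem := one_mem_piece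
  mul_mem i j a b ha hb := by
    have := mul_mem_kernelPiece ha hb
    rwa [← Nat.cast_add] at this

theorem isInternal_kernelPiece (h : IsFundamentalPair D U) :
    DirectSum.IsInternal (fun i : ℕ => kernelPiece D U i) := by
  apply DirectSum.isInternal_submodule_of_iSupIndep_of_iSup_eq_top
  · intro i
    rw [Submodule.disjoint_def]
    intro a ha ha'
    have : ⨆ j : ℕ, ⨆ _ : j ≠ i, kernelPiece D U (j : ℤ) ≤
        LinearMap.ker (h.kernelComponent i) := by
      refine iSup₂_le fun j hj b hb => ?_
      rw [LinearMap.mem_ker, h.kernelComponent_of_mem hb, if_neg (by exact_mod_cast hj)]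
    have h1 := this ha'
    rwa [LinearMap.mem_ker, h.kernelComponent_of_mem ha, if_pos rfl] at h1
  · rw [eq_top_iff]
    intro a _
    exact h.mem_of_kernelComponent _ fun n =>
      Submodule.mem_iSup_of_mem (p := fun i : ℕ => kernelPiece D U (i : ℤ)) n
        (h.kernelComponent_mem n a)

/-- In any expression of `a` through the `f i`, taking components of degree `d` leaves only the
coefficient parts of degree `d - e i`. -/
theorem exists_homogeneous_coeff (h : IsFundamentalPair D U) {ι : Type*} [Fintype ι]
    {f : ι → kernel D} {e : ι → ℤ} (hf : ∀ i, f i ∈ kernelPiece D U (e i)) {d : ℤ}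
    {a : kernel D} (ha : a ∈ kernelPiece D U d) (has : a ∈ Ideal.span (Set.range f)) :
    ∃ c : ι → kernel D, (∀ i, c i ∈ kernelPiece D U (d - e i)) ∧ ∑ i, c i * f i = a := by
  obtain ⟨c, hc⟩ := Ideal.mem_span_range_iff_exists_fun.1 has
  refine ⟨fun i => h.kernelComponent (d - e i) (c i), fun i => h.kernelComponent_mem _ _, ?_⟩
  have h1 := h.kernelComponent_of_mem ha d
  rw [if_pos rfl, ← hc, map_sum] at h1
  rw [← hc, ← h1]
  refine Finset.sum_congr rfl fun i _ => Subtype.ext ?_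
  have := h.component_mul_right (hf i) (d - e i) (c i)
  rw [sub_add_cancel] at this
  exact this.symm

/-- If `I_1 = 0`, then `D^(j+2) b = 0` implies `D^(j+1) b = 0`, because `D^(j+1) b` lies in `I_1`.
Descending gives `D = 0`, and then `2 U = [U, [D, U]] = 0`. -/
theorem exists_imageIdeal_one_ne_zero (h : IsFundamentalPair D U) (hnt : IsNontrivialPair D U) :
    ∃ a ∈ imageIdeal D 1, a ≠ 0 := by
  by_contra! hall
  apply hnt
  have hD : D = 0 := by
    ext b
    obtain ⟨N, hN⟩ := h.locallyNilpotent_left b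
    have : ∀ j ≤ N, D^[N - j + 1] b = 0 := by
      intro j
      induction j with
      | zero => intro _; rw [Nat.sub_zero, Function.iterate_succ_apply', hN, map_zero]
      | succ j ih =>
        intro hj
        have h1 := ih (by omega)
        rw [show N - j + 1 = (N - (j + 1) + 1) + 1 by omega,
          Function.iterate_succ_apply'] at h1
        have h2 := hall ⟨_, h1⟩ (mem_imageIdeal.2 ⟨D^[N - (j + 1)] b, ?_, ?_⟩)
        · exact congrArg Subtype.val h2
        · simpa [← Function.iterate_succ_apply' D] using h1
        · simp [← Function.iterate_succ_apply' D]
    simpa using this N le_rfl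
  refine ⟨hD, ?_⟩
  have h1 := h.lie_right
  rw [hD, zero_lie, lie_zero] at h1
  ext b
  have h2 := congrArg (fun E : Derivation k B B => E b) h1
  simp only [Derivation.coe_zero, Pi.zero_apply, Derivation.coe_smul, Pi.smul_apply] at h2
  rw [← Int.cast_smul_eq_zsmul k, eq_comm, smul_eq_zero] at h2
  simpa using h2

/-! ### Consequences of homogeneous generators of `I_1`. -/

section Generators

variable {ι : Type*} [Fintype ι] {f : ι → kernel D} {e : ι → ℤ} {m : ℕ}

/-- The engine of the degree inductions: each nonzero `f i` has degree at least 1, so the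
coefficients have smaller degree than `a`. The degree `e i` is arbitrary when `f i = 0`, so those
coefficients are reset to zero. -/
theorem exists_sum_of_one_le (h : IsFundamentalPair D U)
    (hf : ∀ i, f i ∈ kernelPiece D U (e i)) (hI : imageIdeal D 1 = Ideal.span (Set.range f))
    {d : ℤ} (hd : 1 ≤ d) {a : kernel D} (ha : a ∈ kernelPiece D U d) :
    ∃ c : ι → kernel D, (∀ i, c i = 0 ∨
      ∃ t : ℕ, c i ∈ kernelPiece D U t ∧ t + e i = d ∧ f i ≠ 0) ∧ ∑ i, c i * f i = a := by
  classical
  obtain ⟨c, hc, hca⟩ := h.exists_homogeneous_coeff hf ha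
    (hI ▸ h.mem_imageIdeal_of_mem_kernelPiece (by exact_mod_cast hd) ha)
  refine ⟨fun i => if f i = 0 then 0 else c i, fun i => ?_, ?_⟩
  · by_cases hfi : f i = 0
    · exact Or.inl (if_pos hfi)
    · simp only [if_neg hfi]
      refine or_iff_not_imp_left.2 fun hci => ?_
      have h0 := h.nonneg_of_kernel (hc i) (c i).2 (by simpa using hci)
      obtain ⟨t, ht⟩ := Int.eq_ofNat_of_zero_le h0
      exact ⟨t, ht ▸ hc i, by omega, hfi⟩
  · rw [← hca]
    refine Finset.sum_congr rfl fun i _ => ?_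
    by_cases hfi : f i = 0 <;> simp [hfi]

omit [Fintype ι] in
theorem one_le_degree (h : IsFundamentalPair D U)
    (hf : ∀ i, f i ∈ kernelPiece D U (e i)) (hI : imageIdeal D 1 = Ideal.span (Set.range f))
    {i : ι} (hi : f i ≠ 0) : 1 ≤ e i := by
  have := h.le_degree_of_mem_imageIdeal (n := 1) (a := f i)
    (hI ▸ Ideal.subset_span ⟨i, rfl⟩) (hf i) hi
  exact_mod_cast this

theorem exists_isGreatest_degree (h : IsFundamentalPair D U) (hnt : IsNontrivialPair D U)
    (hf : ∀ i, f i ∈ kernelPiece D U (e i)) (hI : imageIdeal D 1 = Ideal.span (Set.range f)) :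
    ∃ m : ℕ, IsGreatest {d : ℤ | ∃ i, f i ≠ 0 ∧ f i ∈ kernelPiece D U d} (m : ℤ) := by
  classical
  have hne : (Finset.univ.filter fun i => f i ≠ 0).Nonempty := by
    by_contra hemp
    obtain ⟨a, ha, ha0⟩ := h.exists_imageIdeal_one_ne_zero hnt
    apply ha0
    rw [hI] at ha
    have : Set.range f ⊆ {0} := by
      rintro _ ⟨i, rfl⟩
      by_contra hi
      exact hemp ⟨i, by simpa using hi⟩
    simpa using Ideal.span_mono this ha
  obtain ⟨i, hi, hmax⟩ := Finset.exists_max_image _ e hne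
  simp only [Finset.mem_filter, Finset.mem_univ, true_and] at hi hmax
  have h1 := h.one_le_degree hf hI hi
  refine ⟨(e i).toNat, ?_⟩
  rw [Int.toNat_of_nonneg (by omega)]
  refine ⟨⟨i, hi, hf i⟩, ?_⟩
  rintro d ⟨j, hj, hjd⟩
  rw [h.degree_unique hj hjd (hf j)]
  exact hmax j hj

theorem adjoin_kernelZero_eq (h : IsFundamentalPair D U)
    (hf : ∀ i, f i ∈ kernelPiece D U (e i)) (hI : imageIdeal D 1 = Ideal.span (Set.range f)) :
    (Algebra.adjoin (kernelZero D U) (Set.range fun i => (f i : B))).restrictScalars k =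
      kernel D := by
  set R := Algebra.adjoin (kernelZero D U) (Set.range fun i => (f i : B)) with hR
  apply le_antisymm
  · intro x hx
    refine Algebra.adjoin_induction (p := fun x _ => x ∈ kernel D) ?_ (fun c => c.2.1)
      (fun _ _ _ _ => add_mem) (fun _ _ _ _ => mul_mem) (show x ∈ R from hx)
    rintro _ ⟨i, rfl⟩
    exact (f i).2
  · intro x hx
    have hP : ∀ (n : ℕ) (a : kernel D), a ∈ kernelPiece D U n → (a : B) ∈ R := by
      intro n
      induction n using Nat.strong_induction_on with
      | _ n ih =>
        intro a ha
        rcases Nat.eq_zero_or_pos n with rfl | hn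
        · exact R.algebraMap_mem ⟨a, a.2, ha⟩
        · obtain ⟨c, hc, rfl⟩ := h.exists_sum_of_one_le hf hI (by omega) ha
          rw [AddSubmonoidClass.coe_finsetSum]
          refine sum_mem fun i _ => ?_
          rw [MulMemClass.coe_mul]
          refine mul_mem ?_ (Algebra.subset_adjoin ⟨i, rfl⟩)
          rcases hc i with h0 | ⟨t, ht, hte, hfi⟩
          · rw [h0]; exact zero_mem R
          · have := h.one_le_degree hf hI hfi
            exact ih t (by omega) _ ht
    exact h.mem_of_kernelComponent
      (((R.restrictScalars k).toSubmodule).comap (kernel D).val.toLinearMap) (a := ⟨x, hx⟩)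
      fun n => hP n _ (h.kernelComponent_mem n _)

theorem imageIdeal_eq_span_Ico (h : IsFundamentalPair D U)
    (hf : ∀ i, f i ∈ kernelPiece D U (e i)) (hI : imageIdeal D 1 = Ideal.span (Set.range f))
    (hm : ∀ i, f i ≠ 0 → e i ≤ m) {n : ℕ} (hn : 1 ≤ n) :
    imageIdeal D n = Ideal.span (⋃ i ∈ Set.Ico n (n + m),
      (kernelPiece D U (i : ℤ) : Set (kernel D))) := by
  apply le_antisymm
  · refine h.imageIdeal_le_ideal _ fun i => ?_
    induction i using Nat.strong_induction_on with
    | _ i ih =>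
      intro hi a ha
      rcases lt_or_ge i (n + m) with him | him
      · exact Ideal.subset_span (Set.mem_biUnion ⟨hi, him⟩ ha)
      · obtain ⟨c, hc, rfl⟩ := h.exists_sum_of_one_le hf hI (by omega) ha
        refine sum_mem fun j _ => Ideal.mul_mem_right _ _ ?_
        rcases hc j with h0 | ⟨t, ht, hte, hfj⟩
        · rw [h0]; exact zero_mem _
        · have h1 := h.one_le_degree hf hI hfj
          have h2 := hm j hfj
          exact ih t (by omega) (by omega) _ ht
  · refine Ideal.span_le.2 (Set.iUnion₂_subset fun i hi a ha => ?_)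
    exact h.mem_imageIdeal_of_mem_kernelPiece (by exact_mod_cast hi.1) ha

variable (D m) in
/-- The sum of the ideals `I_1 ^ e_1 ⋯ I_m ^ e_m` over all exponents with `∑ i e_i = n`. -/
def weightedProduct (n : ℕ) : Ideal (kernel D) :=
  ⨆ e ∈ {e : Fin m → ℕ | ∑ i : Fin m, ((i : ℕ) + 1) * e i = n},
    ∏ i : Fin m, imageIdeal D ((i : ℕ) + 1) ^ e i

theorem imageIdeal_pow_le (h : IsFundamentalPair D U) (d t : ℕ) :
    imageIdeal D d ^ t ≤ imageIdeal D (d * t) := by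
  induction t with
  | zero => rw [mul_zero, imageIdeal_zero]; exact le_top
  | succ t ih =>
    rw [pow_succ, mul_add, mul_one]
    exact (Ideal.mul_mono_left ih).trans (h.imageIdeal_mul_le _ _)

theorem weightedProduct_le (h : IsFundamentalPair D U) (m n : ℕ) :
    weightedProduct D m n ≤ imageIdeal D n := by
  refine iSup₂_le ?_
  rintro e rfl
  induction (Finset.univ : Finset (Fin m)) using Finset.cons_induction with
  | empty => rw [Finset.sum_empty, imageIdeal_zero]; exact le_top
  | cons i s hi ih =>
    rw [Finset.prod_cons, Finset.sum_cons]
    exact (Ideal.mul_mono (h.imageIdeal_pow_le _ _) ih).trans (h.imageIdeal_mul_le _ _)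

omit [CharZero k] in
theorem weightedProduct_zero : weightedProduct D m 0 = ⊤ := by
  rw [eq_top_iff]
  exact le_iSup₂_of_le (0 : Fin m → ℕ) (by simp) (by simp)

omit [CharZero k] in
theorem weightedProduct_mul_le (i : Fin m) (n : ℕ) :
    weightedProduct D m n * imageIdeal D ((i : ℕ) + 1) ≤ weightedProduct D m (n + (i + 1)) := by
  classical
  rw [weightedProduct, Submodule.iSup_mul]
  refine iSup_le fun e => ?_
  rw [Submodule.iSup_mul]
  refine iSup_le fun he => ?_
  refine le_iSup₂_of_le (e + Pi.single i 1) ?_ ?_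
  · simp only [Set.mem_ofPred_eq, Pi.add_apply, mul_add, Finset.sum_add_distrib] at he ⊢
    rw [he]
    simp [Pi.single_apply]
  · simp only [Pi.add_apply, pow_add, Finset.prod_mul_distrib]
    rw [Finset.prod_eq_single i (f := fun j : Fin m => imageIdeal D ((j : ℕ) + 1) ^
      (Pi.single i 1 : Fin m → ℕ) j)]
    · simp
    · intro j _ hj
      simp [hj]
    · simp

/-- A homogeneous element of `I_n` is a sum of terms `c j * f j`. With `q = min (e j) n` one has `f
j ∈ I_q` and `c j ∈ I_{n-q}`, and `1 ≤ q ≤ m`, so induction applies to `I_{n-q}`. The argument works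
for every `n`. -/
theorem imageIdeal_eq_weightedProduct (h : IsFundamentalPair D U)
    (hf : ∀ i, f i ∈ kernelPiece D U (e i)) (hI : imageIdeal D 1 = Ideal.span (Set.range f))
    (hm : ∀ i, f i ≠ 0 → e i ≤ m) (n : ℕ) : imageIdeal D n = weightedProduct D m n := by
  refine le_antisymm ?_ (h.weightedProduct_le m n)
  induction n using Nat.strong_induction_on with
  | _ n ih =>
    rcases Nat.eq_zero_or_pos n with rfl | hn
    · rw [weightedProduct_zero]; exact le_top
    refine h.imageIdeal_le_ideal _ fun i hi a ha => ?_
    obtain ⟨c, hc, rfl⟩ := h.exists_sum_of_one_le hf hI (by omega) ha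
    refine sum_mem fun j _ => ?_
    rcases hc j with h0 | ⟨t, ht, hte, hfj⟩
    · rw [h0, zero_mul]; exact zero_mem _
    have h1 := h.one_le_degree hf hI hfj
    have h2 := hm j hfj
    -- The shift by one matches `Fin m` starting at 0: `l` indexes the ideal `I_{l+1}`.
    obtain ⟨l, hl⟩ := Int.eq_ofNat_of_zero_le (show 0 ≤ min (e j) n - 1 by omega)
    have hl' : l + 1 ≤ n := by omega
    have key := weightedProduct_mul_le (D := D) (⟨l, by omega⟩ : Fin m) (n - (l + 1))
    rw [Nat.sub_add_cancel hl'] at key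
    refine key (Ideal.mul_mem_mul (ih _ (by omega) ?_) ?_)
    · exact h.mem_imageIdeal_of_mem_kernelPiece (by omega) ht
    · exact h.mem_imageIdeal_of_mem_kernelPiece (by push_cast; omega) (hf j)

end Generators

/-- `D^n (U^n g_i)` is a multiple of `g_i`, with nonzero scalar when `g_i ≠ 0` because then `g_i`
has degree at least `n`. Hence a combination of the `U^n g_i` has the same image under `D^n` as a
given `b ∈ F_n`, and the difference lies in `F_{n-1}`. -/
theorem degreeModule_eq_span_sup (h : IsFundamentalPair D U) {ι : Type*} [Fintype ι]
    {g : ι → kernel D} {e : ι → ℤ} {n : ℕ} (hn : 1 ≤ n)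
    (hg : ∀ i, g i ∈ kernelPiece D U (e i)) (hI : imageIdeal D n = Ideal.span (Set.range g)) :
    degreeModule D n = Submodule.span (kernel D) (Set.range fun i => U^[n] (g i : B)) ⊔
      degreeModule D (n - 1) := by
  have hladder : ∀ i, D^[n] (U^[n] (g i : B)) = ladder k (e i) n • (g i : B) := fun i =>
    h.iterate_left_iterate_right_of_kernel (hg i) (g i).2 n
  have hpow : ∀ b : B, (kernelLinear D ^ n) b = D^[n] b := fun b => Module.End.pow_apply _ _ _
  apply le_antisymm
  · intro b hb
    rw [mem_degreeModule] at hb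
    have hDb : (⟨D^[n] b, by rwa [Function.iterate_succ_apply'] at hb⟩ : kernel D) ∈
        imageIdeal D n := mem_imageIdeal.2 ⟨b, hb, rfl⟩
    rw [hI] at hDb
    obtain ⟨c, hc⟩ := Ideal.mem_span_range_iff_exists_fun.1 hDb
    set s : B := ∑ i, ((ladder k (e i) n)⁻¹ • c i) • U^[n] (g i : B) with hs
    have hsmem : s ∈ Submodule.span (kernel D) (Set.range fun i => U^[n] (g i : B)) :=
      sum_mem fun i _ => Submodule.smul_mem _ _ (Submodule.subset_span ⟨i, rfl⟩)
    refine Submodule.mem_sup.2 ⟨s, hsmem, b - s, ?_, add_sub_cancel s b⟩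
    rw [mem_degreeModule, Nat.sub_add_cancel hn, ← hpow, map_sub, hs, map_sum, hpow, sub_eq_zero]
    rw [← show _ = D^[n] b from congrArg Subtype.val hc, AddSubmonoidClass.coe_finsetSum]
    refine Finset.sum_congr rfl fun i _ => ?_
    rw [map_smul, hpow, hladder, Subalgebra.smul_def, MulMemClass.coe_mul]
    rcases eq_or_ne (g i) 0 with hgi | hgi
    · simp [hgi]
    · have hgI : g i ∈ imageIdeal D n := hI ▸ Ideal.subset_span (Set.mem_range_self i)
      have hle := h.le_degree_of_mem_imageIdeal hgI (hg i) hgi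
      have := ladder_ne_zero (k := k) hle
      rw [Subalgebra.coe_smul, smul_eq_mul, smul_mul_smul_comm, inv_mul_cancel₀ this, one_smul]
  · refine sup_le (Submodule.span_le.2 ?_) fun b hb => ?_
    · rintro _ ⟨i, rfl⟩
      rw [SetLike.mem_coe, mem_degreeModule, Function.iterate_succ_apply', hladder,
        Derivation.map_smul, show D (g i : B) = 0 from (g i).2, smul_zero]
    · rw [mem_degreeModule, Nat.sub_add_cancel hn] at hb
      rw [mem_degreeModule, Function.iterate_succ_apply', hb, map_zero]

end IsFundamentalPair

end ImageIdeals

/-! ### Direct sum decompositions over `A_0`, and injectivity and surjectivity of `D`. -/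

section DirectSums

variable {k B : Type*} [Field k] [CommRing B] [Algebra k B] {D U : Derivation k B B}

/-- A derivation as a linear operator over a subalgebra of its kernel. -/
def linearOver (D : Derivation k B B) (T : Subalgebra k B) (hT : T ≤ kernel D) : B →ₗ[T] B where
  toFun := D
  map_add' := D.map_add
  map_smul' a b := by
    have ha : D (a : B) = 0 := hT a.2
    simp [Subalgebra.smul_def, ha]

theorem linearOver_apply (T : Subalgebra k B) (hT : T ≤ kernel D) (b : B) :
    linearOver D T hT b = D b := rfl

theorem kernelZero_le_kernel_left : kernelZero D U ≤ kernel D := fun _ h => h.1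

variable (D U) in
/-- The subspace `B_d` as a module over `A_0`. -/
def pieceOver (d : ℤ) : Submodule (kernelZero D U) B where
  carrier := piece D U d
  add_mem' := (piece D U d).add_mem
  zero_mem' := (piece D U d).zero_mem
  smul_mem' a b hb := by
    have := mul_mem_piece a.2.2 hb
    rwa [zero_add] at this

namespace IsFundamentalPair

variable [CharZero k]

/-- A highest weight vector of weight 0 is invariant; this makes `U` linear over `A_0`. -/
theorem kernelZero_le_kernel_right (h : IsFundamentalPair D U) : kernelZero D U ≤ kernel U := by
  rintro a ⟨ha, ha'⟩
  apply h.right_eq_zero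
  have := mem_piece_iff_smul.1 ha'
  rwa [show D a = 0 from ha, map_zero, sub_zero, Int.cast_zero, zero_smul] at this

theorem isDirectSumOver_univ (h : IsFundamentalPair D U) (T : Subalgebra k B)
    (hD : T ≤ kernel D) (hU : T ≤ kernel U) :
    IsDirectSumOver T (Set.univ : Set B) (kernel D : Set B) (Set.range U) := by
  refine ⟨⊤, LinearMap.ker (linearOver D T hD), LinearMap.range (linearOver U T hU),
    Submodule.top_coe, rfl, rfl, ?_, ?_⟩
  · rw [Submodule.disjoint_def]
    rintro _ hx ⟨b, rfl⟩
    exact h.right_eq_zero hx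
  · rw [eq_top_iff]
    intro b _
    obtain ⟨a, c, ha, hac⟩ := h.exists_kernel_add b
    exact hac ▸ Submodule.add_mem_sup ha ⟨c, rfl⟩

/-- Elements of `B_{-2}` have the form `U c` with `c ∈ B_0`, and `D` and `U` commute on `B_0`, so `D
(U c) = U (D c)`. -/
theorem image_left_subset (h : IsFundamentalPair D U) :
    D '' (piece D U (-2) : Set B) ⊆ U '' (piece D U 2 : Set B) := by
  rintro _ ⟨b, hb, rfl⟩
  obtain ⟨c, hc, rfl⟩ := h.exists_right_eq (by norm_num) hb
  refine ⟨D c, ?_, ?_⟩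
  · simpa using h.map_left_mem hc
  · have := mem_piece_iff_smul.1 hc
    rw [neg_add_cancel, Int.cast_zero, zero_smul, sub_eq_zero] at this
    exact this.symm

theorem image_left_eq_image_right (h : IsFundamentalPair D U) :
    D '' (piece D U (-2) : Set B) = U '' (piece D U 2 : Set B) := by
  refine h.image_left_subset.antisymm ?_
  have := h.symm.image_left_subset
  rwa [piece_swap D U, piece_swap D U, neg_neg] at this

theorem isDirectSumOver_piece_zero (h : IsFundamentalPair D U) :
    IsDirectSumOver (kernelZero D U) (piece D U 0 : Set B) (kernelZero D U : Set B)
      (D '' (piece D U (-2) : Set B)) := by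
  refine ⟨pieceOver D U 0, LinearMap.ker (linearOver D _ kernelZero_le_kernel_left) ⊓
      pieceOver D U 0, (pieceOver D U 2).map (linearOver U _ h.kernelZero_le_kernel_right),
    rfl, rfl, h.image_left_eq_image_right.symm, ?_, ?_⟩
  · rw [Submodule.disjoint_def]
    rintro _ hx ⟨b, -, rfl⟩
    exact h.right_eq_zero hx.1
  · apply le_antisymm
    · refine sup_le inf_le_right ?_
      rintro _ ⟨b, hb, rfl⟩
      exact h.map_right_mem hb
    · intro b hb
      obtain ⟨a, ha, ha', c, hc, hac⟩ := h.exists_kernel_add_right 0 hb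
      exact hac ▸ Submodule.add_mem_sup ⟨ha', ha⟩ ⟨c, hc, rfl⟩

theorem left_injOn (h : IsFundamentalPair D U) {n : ℤ} (hn : n ≤ -1) :
    Set.InjOn D (piece D U n) := by
  intro a ha b hb hab
  rw [← sub_eq_zero]
  exact h.eq_zero_of_kernel_of_neg (sub_mem ha hb) (by rw [map_sub, hab, sub_self]) (by omega)

theorem left_surjOn (h : IsFundamentalPair D U) {n : ℤ} (hn : -1 ≤ n) :
    Set.SurjOn D (piece D U n) (piece D U (n + 2)) := by
  intro b hb
  obtain ⟨c, hc, hcb⟩ := h.exists_left_eq (by omega) hb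
  rw [add_sub_cancel_right] at hc
  exact ⟨c, hc, hcb⟩

end IsFundamentalPair

end DirectSums

end FundPair

namespace FundPair

open MvPolynomial

/-! ### Hilbert's finiteness argument for graded subalgebras of polynomial rings. -/

section Hilbert

variable {σ R : Type*} [CommRing R]

theorem homogeneousComponent_mul_of_isHomogeneous {a : MvPolynomial σ R} {e : ℕ}
    (ha : a.IsHomogeneous e) (n : ℕ) (p : MvPolynomial σ R) :
    homogeneousComponent n (p * a) =
      if e ≤ n then homogeneousComponent (n - e) p * a else 0 := by
  induction p using MvPolynomial.induction_on' with
  | monomial u r =>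
    have hu : (monomial u r).IsHomogeneous u.degree := isHomogeneous_monomial r rfl
    rw [homogeneousComponent_of_mem hu, homogeneousComponent_of_mem (hu.mul ha)]
    by_cases h1 : e ≤ n
    · rw [if_pos h1]
      by_cases h2 : n = u.degree + e
      · rw [if_pos h2, if_pos (by omega)]
      · rw [if_neg h2, if_neg (by omega), zero_mul]
    · rw [if_neg h1, if_neg (by omega)]
  | add p q hp hq =>
    rw [add_mul, map_add, map_add, hp, hq]
    split_ifs
    · rw [add_mul]
    · rw [add_zero]

theorem homogeneousComponent_derivation (D : Derivation R (MvPolynomial σ R) (MvPolynomial σ R))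
    (hD : ∀ s, (D (X s)).IsHomogeneous 1) (n : ℕ) (p : MvPolynomial σ R) :
    homogeneousComponent n (D p) = D (homogeneousComponent n p) := by
  induction p using MvPolynomial.induction_on generalizing n with
  | C r =>
    rw [derivation_C, map_zero, homogeneousComponent_of_mem (isHomogeneous_C σ r)]
    split_ifs <;> simp
  | add p q hp hq => rw [map_add, map_add, map_add, map_add, hp, hq]
  | mul_X p s hp =>
    rw [Derivation.leibniz, map_add, smul_eq_mul, smul_eq_mul, mul_comm (X s),
      homogeneousComponent_mul_of_isHomogeneous (hD s),
      homogeneousComponent_mul_of_isHomogeneous (isHomogeneous_X R s),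
      homogeneousComponent_mul_of_isHomogeneous (isHomogeneous_X R s), hp]
    split_ifs
    · rw [Derivation.leibniz, smul_eq_mul, smul_eq_mul, mul_comm (X s)]
    · simp

/-- Hilbert's finiteness theorem: a graded subalgebra of a polynomial ring that has a Reynolds
operator is finitely generated. -/
theorem fg_of_reynolds [Finite σ] [IsNoetherianRing R] (T : Subalgebra R (MvPolynomial σ R))
    (hT : ∀ p ∈ T, ∀ n, homogeneousComponent n p ∈ T)
    (ρ : MvPolynomial σ R →ₗ[T] MvPolynomial σ R) (hρ : ∀ p, ρ p ∈ T)
    (hρT : ∀ p ∈ T, ρ p = p) : T.FG := by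
  obtain ⟨t, htS, hspan⟩ := (Submodule.fg_span_iff_fg_span_finset_subset
    {p : MvPolynomial σ R | p ∈ T ∧ ∃ n, 0 < n ∧ p.IsHomogeneous n}).1
    (IsNoetherian.noetherian (Ideal.span _))
  refine ⟨t, le_antisymm (Algebra.adjoin_le fun p hp => (htS hp).1) ?_⟩
  have hmain : ∀ (n : ℕ) (p : MvPolynomial σ R), p ∈ T → p.IsHomogeneous n →
      p ∈ Algebra.adjoin R (t : Set (MvPolynomial σ R)) := by
    intro n
    induction n using Nat.strong_induction_on with
    | _ n ih =>
      intro p hpT hp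
      rcases Nat.eq_zero_or_pos n with rfl | hn
      · rw [totalDegree_eq_zero_iff_eq_C.1 ((totalDegree_zero_iff_isHomogeneous σ).2 hp)]
        exact Subalgebra.algebraMap_mem _ _
      · have hpS : p ∈ Submodule.span (MvPolynomial σ R) (t : Set (MvPolynomial σ R)) := by
          rw [← hspan]
          exact Submodule.subset_span ⟨hpT, n, hn, hp⟩
        obtain ⟨f, -, hf⟩ := Submodule.mem_span_finset.1 hpS
        -- Applying `ρ` to `p = ∑ f a * a` puts the coefficients in `T`. Since `ρ` need not preserve
        -- degrees, the component of degree `n` is taken afterwards; it leaves coefficients of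
        -- degree less than `n`, as every `a` has positive degree.
        have h1 : p = homogeneousComponent n (ρ p) := by
          rw [hρT p hpT, homogeneousComponent_eq_self hp]
        rw [← hf, map_sum, map_sum] at h1
        rw [hf] at h1
        rw [h1]
        refine sum_mem fun a ha => ?_
        obtain ⟨haT, e, he, hae⟩ := htS ha
        have h2 : ρ (f a • a) = ρ (f a) * a := by
          have := ρ.map_smul ⟨a, haT⟩ (f a)
          rwa [Subalgebra.smul_def, Subalgebra.smul_def, smul_eq_mul, smul_eq_mul, mul_comm,
            mul_comm a] at this
        rw [h2, homogeneousComponent_mul_of_isHomogeneous hae]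
        split_ifs
        · exact mul_mem (ih _ (by omega) _ (hT _ (hρ _) _)
            (homogeneousComponent_isHomogeneous _ _)) (Algebra.subset_adjoin ha)
        · exact zero_mem _
  intro p hp
  rw [← sum_homogeneousComponent p]
  exact sum_mem fun n _ => hmain n _ (hT p hp n) (homogeneousComponent_isHomogeneous n p)

end Hilbert

/-! ### The Reynolds operator onto the invariants `A_0`. -/

section Reynolds

variable {k B : Type*} [Field k] [CharZero k] [CommRing B] [Algebra k B] {D U : Derivation k B B}

/-- `ρ` is the projection along `q = im D + im U`. Negative weights lie in `im U`, positive ones in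
`im D`, and `B_0 = A_0 + U B_2`. For directness, an invariant in `q` equals its weight 0 component,
which lies in `D B_{-2} + U B_2 ⊆ im U`, and `ker D ∩ im U = 0`. -/
theorem IsFundamentalPair.exists_reynolds (h : IsFundamentalPair D U) :
    ∃ ρ : B →ₗ[kernelZero D U] B, (∀ b, ρ b ∈ kernelZero D U) ∧
      ∀ b ∈ kernelZero D U, ρ b = b := by
  set p := LinearMap.ker (linearOver D _ (kernelZero_le_kernel_left (D := D) (U := U))) ⊓
    pieceOver D U 0
  set q := LinearMap.range (linearOver D _ (kernelZero_le_kernel_left (D := D) (U := U))) ⊔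
    LinearMap.range (linearOver U _ h.kernelZero_le_kernel_right)
  have hpq : IsCompl p q := by
    refine ⟨Submodule.disjoint_def.2 ?_, codisjoint_iff_le_sup.2 ?_⟩
    · rintro x ⟨hx, hx'⟩ hxq
      obtain ⟨_, ⟨b, rfl⟩, _, ⟨c, rfl⟩, rfl⟩ := Submodule.mem_sup.1 hxq
      rw [linearOver_apply, linearOver_apply] at *
      have h1 := h.component_same hx'
      obtain ⟨d, hd, hdb⟩ := h.image_left_subset
        ⟨_, h.component_mem (-2) b, rfl⟩
      have h2 := h.component_left (-2) b
      rw [map_add, h.component_right, show (0 : ℤ) = -2 + 2 by norm_num, h2, ← hdb,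
        ← map_add] at h1
      rw [← h1]
      apply h.right_eq_zero
      rw [h1]
      exact hx
    · intro b _
      refine h.mem_of_component ((p ⊔ q).restrictScalars k) fun d => ?_
      have hd := h.component_mem d b
      rcases lt_trichotomy d 0 with h0 | h0 | h0
      · obtain ⟨c, -, hc⟩ := h.exists_right_eq (by omega) hd
        exact Submodule.mem_sup_right (Submodule.mem_sup_right ⟨c, hc⟩)
      · subst h0
        obtain ⟨a, ha, ha', c, -, hac⟩ := h.exists_kernel_add_right 0 hd
        rw [← hac]
        exact Submodule.add_mem_sup (T := q) (show a ∈ p from ⟨ha', ha⟩)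
          (Submodule.mem_sup_right ⟨c, rfl⟩)
      · obtain ⟨c, -, hc⟩ := h.exists_left_eq (by omega) hd
        exact Submodule.mem_sup_right (Submodule.mem_sup_left ⟨c, hc⟩)
  exact ⟨p.projection q hpq, fun b => Submodule.projection_apply_mem hpq b,
    fun b hb => Submodule.projection_apply_of_mem_left hpq ⟨hb.1, hb.2⟩⟩

end Reynolds

/-! ### Polynomial rings on finite ladders of variables as sl₂-algebras. -/

section PolynomialModel

variable (k : Type*) [Field k] {ι : Type*} (n : ι → ℕ)

/-- The variable `X_{i,j}` of the polynomial ring in the variables `X_{i,j}`, `0 ≤ j ≤ n_i`,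
extended by zero to all `j`. -/
noncomputable def ladderX (i : ι) (j : ℕ) : MvPolynomial (Σ i, Fin (n i + 1)) k :=
  if h : j < n i + 1 then X ⟨i, j, h⟩ else 0

/-- The derivation `X_{i,j} ↦ j (n_i - j + 1) X_{i,j-1}`. -/
noncomputable def raise :
    Derivation k (MvPolynomial (Σ i, Fin (n i + 1)) k) (MvPolynomial (Σ i, Fin (n i + 1)) k) :=
  mkDerivation k fun p =>
    ((((p.2 : ℕ) : ℤ) * (n p.1 - (p.2 : ℕ) + 1) : ℤ) : k) • ladderX k n p.1 (p.2 - 1)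

/-- The derivation `X_{i,j} ↦ X_{i,j+1}`. -/
noncomputable def lower :
    Derivation k (MvPolynomial (Σ i, Fin (n i + 1)) k) (MvPolynomial (Σ i, Fin (n i + 1)) k) :=
  mkDerivation k fun p => ladderX k n p.1 (p.2 + 1)

variable {k n}

theorem X_eq_ladderX (p : Σ i, Fin (n i + 1)) :
    (X p : MvPolynomial (Σ i, Fin (n i + 1)) k) = ladderX k n p.1 p.2 := by
  rw [ladderX, dif_pos p.2.2]

theorem ladderX_isHomogeneous (i : ι) (j : ℕ) : (ladderX k n i j).IsHomogeneous 1 := by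
  rw [ladderX]
  split_ifs
  · exact isHomogeneous_X k _
  · exact isHomogeneous_zero _ _ _

theorem lower_ladderX (i : ι) (j : ℕ) : lower k n (ladderX k n i j) = ladderX k n i (j + 1) := by
  by_cases h : j < n i + 1
  · rw [ladderX, dif_pos h, lower, mkDerivation_X]
  · rw [ladderX, dif_neg h, map_zero, ladderX, dif_neg (by omega)]

theorem raise_ladderX (i : ι) (j : ℕ) : raise k n (ladderX k n i j) =
    (((j : ℤ) * (n i - j + 1) : ℤ) : k) • ladderX k n i (j - 1) := by
  by_cases h : j < n i + 1
  · rw [ladderX, dif_pos h, raise, mkDerivation_X]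
  · rw [ladderX, dif_neg h, map_zero]
    -- Just past the top of the ladder `X_{i,j-1}` is a genuine variable, but its scalar vanishes;
    -- beyond that both variables are zero.
    rcases eq_or_ne j (n i + 1) with h1 | h1
    · rw [h1]
      push_cast
      simp
    · rw [ladderX, dif_neg (by omega), smul_zero]

theorem lie_ladderX (i : ι) (j : ℕ) : ⁅raise k n, lower k n⁆ (ladderX k n i j) =
    ((n i : k) - 2 * j) • ladderX k n i j := by
  rw [Derivation.commutator_apply, lower_ladderX, raise_ladderX, raise_ladderX,
    Derivation.map_smul, lower_ladderX, Nat.add_sub_cancel]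
  cases j with
  | zero => push_cast; module
  | succ j =>
    rw [Nat.add_sub_cancel]
    push_cast
    module

/-- By Leibniz, each application of `D` lowers the nilpotency order of one of the two factors, so `i
+ j - 1` applications suffice. -/
theorem iterate_mul_eq_zero {B : Type*} [CommRing B] [Algebra k B] (D : Derivation k B B)
    (N : ℕ) {i j : ℕ} (hij : i + j ≤ N + 1) {a b : B} (ha : D^[i] a = 0) (hb : D^[j] b = 0) :
    D^[N] (a * b) = 0 := by
  induction N generalizing i j a b with
  | zero =>
    rcases Nat.eq_zero_or_pos i with rfl | hi
    · rw [Function.iterate_zero, id] at ha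
      rw [ha, zero_mul, iterate_map_zero]
    · obtain rfl : j = 0 := by omega
      rw [Function.iterate_zero, id] at hb
      rw [hb, mul_zero, iterate_map_zero]
  | succ N ih =>
    cases i with
    | zero =>
      rw [Function.iterate_zero, id] at ha
      rw [ha, zero_mul, iterate_map_zero]
    | succ i =>
      cases j with
      | zero =>
        rw [Function.iterate_zero, id] at hb
        rw [hb, mul_zero, iterate_map_zero]
      | succ j =>
        rw [Function.iterate_succ_apply, Derivation.leibniz, iterate_map_add, smul_eq_mul,
          smul_eq_mul,
          ih (i := i + 1) (j := j) (by omega) ha (by rwa [← Function.iterate_succ_apply]),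
          ih (i := j + 1) (j := i) (by omega) hb (by rwa [← Function.iterate_succ_apply]), add_zero]

theorem isLocallyNilpotent_of_X {σ : Type*}
    {D : Derivation k (MvPolynomial σ k) (MvPolynomial σ k)} (hD : ∀ s, ∃ N, D^[N] (X s) = 0) :
    IsLocallyNilpotent D := by
  intro p
  induction p using MvPolynomial.induction_on with
  | C r => exact ⟨1, derivation_C D r⟩
  | add p q hp hq =>
    obtain ⟨i, hi⟩ := hp
    obtain ⟨j, hj⟩ := hq
    refine ⟨i + j, ?_⟩
    rw [iterate_map_add, Function.iterate_add_apply D i j q, hj, iterate_map_zero, add_comm i,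
      Function.iterate_add_apply, hi, iterate_map_zero, add_zero]
  | mul_X p s hp =>
    obtain ⟨i, hi⟩ := hp
    obtain ⟨j, hj⟩ := hD s
    exact ⟨i + j, iterate_mul_eq_zero D _ (by omega) hi hj⟩

theorem lower_iterate_ladderX (i : ι) (j m : ℕ) :
    (lower k n)^[m] (ladderX k n i j) = ladderX k n i (j + m) := by
  induction m with
  | zero => rfl
  | succ m ih => rw [Function.iterate_succ_apply', ih, lower_ladderX, add_assoc]

theorem ladderX_mem_piece (i : ι) (j : ℕ) :
    ladderX k n i j ∈ piece (raise k n) (lower k n) (n i - 2 * j) := by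
  rw [mem_piece, lie_ladderX, ← Int.cast_smul_eq_zsmul k]
  push_cast
  rfl

theorem isFundamentalPair_raise_lower : IsFundamentalPair (raise k n) (lower k n) where
  locallyNilpotent_left := by
    refine isLocallyNilpotent_of_X fun s => ⟨s.2 + 1, ?_⟩
    rw [X_eq_ladderX]
    generalize (s.2 : ℕ) = j
    induction j with
    | zero => simp [raise_ladderX]
    | succ j ih => rw [Function.iterate_succ_apply, raise_ladderX, iterate_smul,
        Nat.add_sub_cancel, ih, smul_zero]
  locallyNilpotent_right := by
    refine isLocallyNilpotent_of_X fun s => ⟨n s.1 + 1, ?_⟩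
    rw [X_eq_ladderX, lower_iterate_ladderX, ladderX, dif_neg (by omega)]
  lie_left := by
    refine MvPolynomial.derivation_ext fun s => ?_
    rw [X_eq_ladderX, Derivation.commutator_apply, lie_ladderX, Derivation.map_smul,
      raise_ladderX, Derivation.map_smul, lie_ladderX, Derivation.smul_apply, raise_ladderX,
      ← Int.cast_smul_eq_zsmul k]
    rcases Nat.eq_zero_or_pos (s.2 : ℕ) with h | h
    · simp [h]
    · push_cast [Nat.cast_sub (show 1 ≤ (s.2 : ℕ) from h)]
      module
  lie_right := by
    refine MvPolynomial.derivation_ext fun s => ?_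
    rw [X_eq_ladderX, Derivation.commutator_apply, lie_ladderX, Derivation.map_smul,
      lower_ladderX, lie_ladderX, Derivation.smul_apply, lower_ladderX,
      ← Int.cast_smul_eq_zsmul k]
    push_cast
    module
  sum_pieces := by
    rw [eq_top_iff]
    intro p _
    induction p using MvPolynomial.induction_on with
    | C r =>
      refine Submodule.mem_iSup_of_mem 0 ?_
      rw [mem_piece, derivation_C, zero_smul]
    | add p q hp hq => exact add_mem (hp trivial) (hq trivial)
    | mul_X p s hp =>
      refine Submodule.iSup_induction (piece (raise k n) (lower k n))
        (motive := fun p => p * X s ∈ ⨆ d, piece (raise k n) (lower k n) d) (hp trivial)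
        (fun d q hq => ?_) ?_ fun q r hq hr => ?_
      · rw [X_eq_ladderX]
        exact Submodule.mem_iSup_of_mem _ (mul_mem_piece hq (ladderX_mem_piece s.1 s.2))
      · rw [zero_mul]
        exact zero_mem _
      · rw [add_mul]
        exact add_mem hq hr

/-- Both derivations send variables to linear forms, hence preserve polynomial degree, and the
invariants form a graded subalgebra to which Hilbert's argument applies. -/
theorem kernelZero_raise_lower_fg [CharZero k] [Finite ι] :
    (kernelZero (raise k n) (lower k n)).FG := by
  have h := isFundamentalPair_raise_lower (k := k) (n := n)
  have hr : ∀ s, (raise k n (X s)).IsHomogeneous 1 := fun s => by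
    rw [X_eq_ladderX, raise_ladderX]
    exact (homogeneousSubmodule _ k 1).smul_mem _ (ladderX_isHomogeneous _ _)
  have hl : ∀ s, (lower k n (X s)).IsHomogeneous 1 := fun s => by
    rw [X_eq_ladderX, lower_ladderX]
    exact ladderX_isHomogeneous _ _
  obtain ⟨ρ, hρ, hρT⟩ := h.exists_reynolds
  refine fg_of_reynolds _ ?_ ρ hρ hρT
  rintro p ⟨hp, hp'⟩ d
  constructor
  · rw [mem_kernel] at *
    rw [← homogeneousComponent_derivation _ hr, hp, map_zero]
  · rw [mem_piece_iff_smul] at *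
    rw [← homogeneousComponent_derivation _ hl, ← homogeneousComponent_derivation _ hr,
      ← homogeneousComponent_derivation _ hr, ← homogeneousComponent_derivation _ hl, ← map_sub,
      hp', map_smul]

section Eval

variable {B : Type*} [CommRing B] [Algebra k B]

variable (k n) in
/-- The homomorphism `X_{i,j} ↦ v_{i,j}`. -/
noncomputable def evalLadder (v : ι → ℕ → B) : MvPolynomial (Σ i, Fin (n i + 1)) k →ₐ[k] B :=
  aeval fun p => v p.1 p.2

theorem evalLadder_ladderX {v : ι → ℕ → B} (hv : ∀ i j, n i < j → v i j = 0) (i : ι) (j : ℕ) :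
    evalLadder k n v (ladderX k n i j) = v i j := by
  rw [ladderX]
  split_ifs with h
  · rw [evalLadder, aeval_X]
  · rw [map_zero, hv i j (by omega)]

theorem algHom_derivation {σ : Type*}
    {E : Derivation k (MvPolynomial σ k) (MvPolynomial σ k)} {D : Derivation k B B}
    (θ : MvPolynomial σ k →ₐ[k] B) (hθ : ∀ s, θ (E (X s)) = D (θ (X s)))
    (p : MvPolynomial σ k) : θ (E p) = D (θ p) := by
  induction p using MvPolynomial.induction_on with
  | C r =>
    rw [derivation_C, map_zero, ← algebraMap_eq, AlgHom.commutes, Derivation.map_algebraMap]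
  | add p q hp hq => rw [map_add, map_add, map_add, map_add, hp, hq]
  | mul_X p s hp =>
    rw [Derivation.leibniz, map_add, map_mul, Derivation.leibniz, smul_eq_mul, smul_eq_mul,
      smul_eq_mul, smul_eq_mul, map_mul, map_mul, hp, hθ]

theorem evalLadder_raise {D : Derivation k B B} {v : ι → ℕ → B}
    (hv : ∀ i j, n i < j → v i j = 0)
    (hD : ∀ i j, D (v i j) = (((j : ℤ) * (n i - j + 1) : ℤ) : k) • v i (j - 1))
    (p : MvPolynomial (Σ i, Fin (n i + 1)) k) :
    evalLadder k n v (raise k n p) = D (evalLadder k n v p) := by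
  refine algHom_derivation _ (fun s => ?_) p
  rw [X_eq_ladderX, raise_ladderX, map_smul, evalLadder_ladderX hv, evalLadder_ladderX hv, hD]

theorem evalLadder_lower {U : Derivation k B B} {v : ι → ℕ → B}
    (hv : ∀ i j, n i < j → v i j = 0) (hU : ∀ i j, U (v i j) = v i (j + 1))
    (p : MvPolynomial (Σ i, Fin (n i + 1)) k) :
    evalLadder k n v (lower k n p) = U (evalLadder k n v p) := by
  refine algHom_derivation _ (fun s => ?_) p
  rw [X_eq_ladderX, lower_ladderX, evalLadder_ladderX hv, evalLadder_ladderX hv, hU]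

end Eval

end PolynomialModel

end FundPair

namespace FundPair

open MvPolynomial

/-! ### Equivariant quotients and finite generation of `ker D`. -/

section Equivariant

variable {k B S : Type*} [Field k] [CharZero k] [CommRing B] [Algebra k B] [CommRing S]
  [Algebra k S] {D U : Derivation k B B} {E F : Derivation k S S}

namespace IsFundamentalPair

theorem iterate_right_eq_zero_of_kernel (h : IsFundamentalPair D U) {n : ℕ} {a : B}
    (ha : a ∈ piece D U n) (ha' : D a = 0) {j : ℕ} (hj : n < j) : U^[j] a = 0 := by
  have h1 : U^[n + 1] a = 0 := by
    refine h.eq_zero_of_kernel_of_neg (h.iterate_right_mem ha (n + 1)) ?_ (by push_cast; omega)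
    rw [h.left_iterate_right_of_kernel ha ha']
    push_cast
    simp
  rw [← Nat.sub_add_cancel (show n + 1 ≤ j from hj), Function.iterate_add_apply, h1,
    iterate_map_zero]

/-- Highest weight vectors lift along surjective equivariant homomorphisms. -/
theorem exists_kernel_lift (h : IsFundamentalPair D U) (h' : IsFundamentalPair E F)
    (θ : S →ₐ[k] B) (hθ : Function.Surjective θ) (hE : ∀ s, θ (E s) = D (θ s))
    (hF : ∀ s, θ (F s) = U (θ s)) {d : ℤ} {a : B} (ha : a ∈ piece D U d) (ha' : D a = 0) :
    ∃ s ∈ piece E F d, E s = 0 ∧ θ s = a := by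
  have hmem : ∀ {e : ℤ} {s : S}, s ∈ piece E F e → θ s ∈ piece D U e := by
    intro e s hs
    rw [mem_piece_iff_smul] at *
    rw [← hE, ← hF, ← hF, ← hE, ← map_sub, hs, map_smul]
  have hcomp : ∀ s, θ (h'.component d s) = h.component d (θ s) := by
    intro s
    refine h'.induction_piece (P := fun s => θ (h'.component d s) = h.component d (θ s))
      (by simp) (fun a b ha hb => by simp [ha, hb]) (fun e b hb => ?_) s
    rw [h'.component_apply_of_mem hb, h.component_apply_of_mem (hmem hb)]
    split_ifs <;> simp
  obtain ⟨p, rfl⟩ := hθ a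
  obtain ⟨s, hs, hs', c, -, hsc⟩ := h'.exists_kernel_add_right d (h'.component_mem d p)
  refine ⟨s, hs, hs', ?_⟩
  have h1 : θ s + U (θ c) = θ p := by
    rw [← hF, ← map_add, hsc, hcomp, h.component_same ha]
  -- Both `a` and `θ s` are killed by `D`, so `U (θ c)` lies in `ker D ∩ im U`.
  have h2 : U (θ c) = 0 := by
    apply h.right_eq_zero
    rw [← h1, map_add, ← hE, hs', map_zero, zero_add] at ha'
    exact ha'
  rwa [h2, add_zero] at h1

/-- An element of degree `n` of `ker D` is the coefficient of `y ^ n` of an invariant in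
`x` and `y`, where `x, y` span a copy of the standard representation. -/
theorem exists_invariant (h : IsFundamentalPair D U) {x y : B} (hx : x ∈ piece D U 1)
    (hy : y ∈ piece D U (-1)) (hDx : D x = 0) (hDy : D y = x) {n : ℕ} {s : B}
    (hs : s ∈ piece D U n) (hDs : D s = 0) :
    ∃ t ∈ kernelZero D U, ∃ r, t = s * y ^ n + x * r := by
  set c : ℕ → k := fun j => (-1) ^ j / (j.factorial : k) with hc
  have hc_succ : ∀ j : ℕ, c (j + 1) * ((j : k) + 1) = - c j := by
    intro j
    have h1 : ((j.factorial : ℕ) : k) ≠ 0 := Nat.cast_ne_zero.2 j.factorial_ne_zero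
    have h2 : (j : k) + 1 ≠ 0 := by exact_mod_cast Nat.succ_ne_zero j
    simp only [hc, Nat.factorial_succ]
    push_cast
    field_simp
    ring
  set term : ℕ → B := fun j => c j • (U^[j] s * (x ^ j * y ^ (n - j)))
  set bd : ℕ → B := fun j => Nat.casesOn j 0 fun j =>
    (c j * ((n : k) - j)) • (U^[j] s * (x ^ (j + 1) * y ^ (n - (j + 1)))) with hbd
  have hDxy : ∀ j ≤ n, D (x ^ j * y ^ (n - j)) =
      ((n : k) - j) • (x ^ (j + 1) * y ^ (n - (j + 1))) := by
    intro j hj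
    rw [Derivation.leibniz, Derivation.leibniz_pow, Derivation.leibniz_pow, hDx, hDy, smul_zero,
      smul_zero, smul_zero, add_zero, smul_eq_mul, smul_eq_mul, ← Nat.cast_sub hj, Nat.sub_sub,
      ← Nat.cast_smul_eq_nsmul k, mul_smul_comm, pow_succ]
    congr 1
    ring
  have hterm : ∀ j ≤ n, D (term j) = bd (j + 1) - bd j := by
    intro j hj
    simp only [term, hbd]
    rw [Derivation.map_smul, Derivation.leibniz, hDxy j hj]
    cases j with
    | zero => simp [hDs, smul_smul]
    | succ j =>
      rw [h.left_iterate_right_of_kernel hs hDs]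
      simp only [smul_eq_mul, mul_smul_comm, smul_add, smul_smul]
      have := hc_succ j
      have h3 : c (j + 1) * (((j + 1) * (n - j) : ℤ) : k) = - (c j * ((n : k) - j)) := by
        push_cast
        linear_combination ((n : k) - j) * this
      rw [h3, mul_comm (x ^ (j + 1) * y ^ (n - (j + 1)))]
      module
  have hmem : ∀ j ≤ n, term j ∈ piece D U 0 := by
    intro j hj
    refine Submodule.smul_mem _ _ ?_
    have := mul_mem_piece (h.iterate_right_mem hs j)
      (mul_mem_piece (pow_mem_piece hx j) (pow_mem_piece hy (n - j)))
    convert this using 1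
    push_cast [Nat.cast_sub hj]
    ring_nf
  refine ⟨∑ j ∈ Finset.range (n + 1), term j, ⟨?_, ?_⟩, ?_⟩
  · rw [mem_kernel, map_sum, Finset.sum_congr rfl fun j hj =>
      hterm j (Nat.lt_succ_iff.1 (Finset.mem_range.1 hj)), Finset.sum_range_sub]
    simp [hbd]
  · exact sum_mem fun j hj => hmem j (Nat.lt_succ_iff.1 (Finset.mem_range.1 hj))
  · refine ⟨∑ j ∈ Finset.range n, c (j + 1) • (U^[j + 1] s * (x ^ j * y ^ (n - (j + 1)))), ?_⟩
    rw [Finset.sum_range_succ', add_comm, Finset.mul_sum]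
    congr 1
    · simp [term, hc]
    · refine Finset.sum_congr rfl fun j _ => ?_
      simp only [term]
      rw [mul_smul_comm, pow_succ]
      congr 1
      ring

/-- Nonnegative weights are covered by `kernel_induction_of_nonneg`. Negative weights are reached
from them by applying `U` repeatedly, and the span is stable under `U`. -/
theorem span_iterate_right_eq_top (h : IsFundamentalPair D U) :
    Submodule.span k {b : B | ∃ (n : ℕ) (a : B) (j : ℕ), a ∈ piece D U n ∧ D a = 0 ∧
      U^[j] a = b} = ⊤ := by
  set W := Submodule.span k {b : B | ∃ (n : ℕ) (a : B) (j : ℕ), a ∈ piece D U n ∧ D a = 0 ∧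
    U^[j] a = b} with hW
  have hUW : ∀ b ∈ W, U b ∈ W := by
    intro b hb
    have : W ≤ W.comap U.toLinearMap := by
      refine Submodule.span_le.2 ?_
      rintro _ ⟨n, a, j, ha, ha', rfl⟩
      exact Submodule.subset_span ⟨n, a, j + 1, ha, ha', Function.iterate_succ_apply' U j a⟩
    exact this hb
  have hnonneg : ∀ d : ℤ, 0 ≤ d → ∀ b ∈ piece D U d, b ∈ W := by
    intro d hd b hb
    obtain ⟨n, rfl⟩ := Int.eq_ofNat_of_zero_le hd
    exact h.kernel_induction_of_nonneg hd W (fun j a ha ha' =>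
      Submodule.subset_span ⟨n + 2 * j, a, j, by exact_mod_cast ha, ha', rfl⟩) hb
  have hneg : ∀ N : ℕ, ∀ d : ℤ, -N ≤ d → ∀ b ∈ piece D U d, b ∈ W := by
    intro N
    induction N with
    | zero => intro d hd; exact hnonneg d (by simpa using hd)
    | succ N ih =>
      intro d hd b hb
      rcases lt_or_ge d 0 with h0 | h0
      · obtain ⟨c, hc, rfl⟩ := h.exists_right_eq (by omega) hb
        exact hUW c (ih (d + 2) (by push_cast at hd; omega) c hc)
      · exact hnonneg d h0 b hb
  rw [← top_le_iff, ← h.sum_pieces]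
  exact iSup_le fun d => hneg d.natAbs d (by omega)

theorem exists_finite_generators [Algebra.FiniteType k B] (h : IsFundamentalPair D U) :
    ∃ (ι : Set B) (_ : Finite ι) (n : ι → ℕ) (a : ι → B), (∀ i, a i ∈ piece D U (n i)) ∧
      (∀ i, D (a i) = 0) ∧
      Algebra.adjoin k (Set.range fun p : ι × ℕ => U^[p.2] (a p.1)) = ⊤ := by
  obtain ⟨G, hG⟩ := (Algebra.FiniteType.out : (⊤ : Subalgebra k B).FG)
  have hGX : (G : Set B) ⊆ Submodule.span k {b : B | ∃ (n : ℕ) (a : B) (j : ℕ),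
      a ∈ piece D U n ∧ D a = 0 ∧ U^[j] a = b} := by
    rw [h.span_iterate_right_eq_top]
    exact Set.subset_univ _
  obtain ⟨t, htX, hGt⟩ := Submodule.subset_span_finite_of_subset_span hGX
  replace htX : ∀ b ∈ t, ∃ (n : ℕ) (a : B) (j : ℕ),
    a ∈ piece D U n ∧ D a = 0 ∧ U^[j] a = b := fun b hb => htX hb
  choose! n a j ha ha' haj using htX
  refine ⟨t, inferInstance, fun i => n i, fun i => a i, fun i => ha i i.2, fun i => ha' i i.2, ?_⟩
  rw [← top_le_iff, ← hG]
  refine Algebra.adjoin_le (hGt.trans ?_)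
  intro x hx
  refine Algebra.adjoin_mono ?_ (Algebra.span_le_adjoin k _ hx)
  intro b hb
  exact ⟨(⟨b, hb⟩, j b), haj b hb⟩

/-- Finite generation of the kernel of `D`. -/
theorem kernel_fg [Algebra.FiniteType k B] (h : IsFundamentalPair D U) : (kernel D).FG := by
  obtain ⟨ι, _, n, a, ha, ha', hgen⟩ := h.exists_finite_generators
  set v : ι → ℕ → B := fun i j => U^[j] (a i)
  have hv : ∀ i j, n i < j → v i j = 0 := fun i j hij =>
    h.iterate_right_eq_zero_of_kernel (ha i) (ha' i) hij
  have hvD : ∀ i j, D (v i j) = (((j : ℤ) * (n i - j + 1) : ℤ) : k) • v i (j - 1) := by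
    intro i j
    cases j with
    | zero => simp [v, ha' i]
    | succ j =>
      simp only [v]
      rw [h.left_iterate_right_of_kernel (ha i) (ha' i), Nat.add_sub_cancel]
      push_cast
      ring_nf
  have hvU : ∀ i j, U (v i j) = v i (j + 1) := fun i j =>
    (Function.iterate_succ_apply' U j (a i)).symm
  have hS := isFundamentalPair_raise_lower (k := k) (n := n)
  -- The extra ladder `none`, of length two, adjoins the standard representation with basis `x =
  -- X_{none,0}`, `y = X_{none,1}`.
  set n' : Option ι → ℕ := fun o => o.elim 1 n
  have hS' := isFundamentalPair_raise_lower (k := k) (n := n')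
  set θ := evalLadder k n v
  have hθ : Function.Surjective θ := by
    rw [← AlgHom.range_eq_top, ← top_le_iff, ← hgen]
    refine Algebra.adjoin_le ?_
    rintro _ ⟨p, rfl⟩
    exact ⟨ladderX k n p.1 p.2, evalLadder_ladderX hv _ _⟩
  -- The substitution `x = 0`, `y = 1` respects `D`, since `D 1 = 0`, but not `U`; compatibility
  -- with `D` is enough for invariants to land in `ker D`.
  set w : Option ι → ℕ → B := fun o => o.elim (fun j => if j = 1 then 1 else 0) v with hw
  have hwv : ∀ o j, n' o < j → w o j = 0 := by
    rintro (_ | i) j hij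
    · exact if_neg (ne_of_gt hij)
    · exact hv i j hij
  have hwD : ∀ o j, D (w o j) = (((j : ℤ) * (n' o - j + 1) : ℤ) : k) • w o (j - 1) := by
    rintro (_ | i) j
    · simp only [hw, n', Option.elim]
      split_ifs with h1 h2 h2
      · omega
      · simp
      · obtain rfl : j = 2 := by omega
        simp
      · simp
    · exact hvD i j
  set ψ := evalLadder k n' w
  set inc := evalLadder k n fun i j => ladderX k n' (some i) j
  have hinc0 : ∀ i j, n i < j → ladderX k n' (some i) j = 0 := fun i j hij => by
    rw [ladderX, dif_neg]
    simp only [n', Option.elim]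
    omega
  have hincE := evalLadder_raise (D := raise k n') hinc0 fun i j => raise_ladderX (some i) j
  have hincF := evalLadder_lower (U := lower k n') hinc0 fun i j => lower_ladderX (some i) j
  have hψinc : ∀ p, ψ (inc p) = θ p := by
    intro p
    have : ψ.comp inc = θ := by
      refine MvPolynomial.algHom_ext fun s => ?_
      rw [X_eq_ladderX, AlgHom.comp_apply, evalLadder_ladderX hinc0, evalLadder_ladderX hwv,
        evalLadder_ladderX hv]
      rfl
    exact DFunLike.congr_fun this p
  have hx : ladderX k n' none 0 ∈ piece (raise k n') (lower k n') 1 :=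
    ladderX_mem_piece (n := n') none 0
  have hy : ladderX k n' none 1 ∈ piece (raise k n') (lower k n') (-1) :=
    ladderX_mem_piece (n := n') none 1
  have hmap : (kernelZero (raise k n') (lower k n')).map ψ = kernel D := by
    apply le_antisymm
    · rintro _ ⟨t, ht, rfl⟩
      change D (ψ t) = 0
      rw [← evalLadder_raise hwv hwD, show raise k n' t = 0 from ht.1, map_zero]
    · intro b hb
      refine h.mem_of_kernelComponent (((kernelZero (raise k n') (lower k n')).map
        ψ).toSubmodule.comap (kernel D).val.toLinearMap) (a := ⟨b, hb⟩) fun d => ?_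
      obtain ⟨s, hs, hs', hsθ⟩ := h.exists_kernel_lift hS θ hθ (evalLadder_raise hv hvD)
        (evalLadder_lower hv hvU) (h.kernelComponent_mem d ⟨b, hb⟩)
        (h.kernelComponent d ⟨b, hb⟩).2
      have hincs : inc s ∈ piece (raise k n') (lower k n') d := by
        rw [mem_piece_iff_smul] at *
        rw [← hincE, ← hincF, ← hincF, ← hincE, ← map_sub, hs, map_smul]
      -- The invariant has the form `s * y^d + x * r`, so setting `x = 0`, `y = 1` recovers the
      -- image of `s`.
      obtain ⟨t, ht, r, htr⟩ := hS'.exists_invariant hx hy (by simp [raise_ladderX])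
        (by simp [raise_ladderX, n']) hincs (by rw [← hincE, hs', map_zero])
      refine ⟨t, ht, ?_⟩
      change ψ t = (h.kernelComponent d ⟨b, hb⟩ : B)
      rw [htr, map_add, map_mul, map_mul, map_pow, evalLadder_ladderX hwv,
        evalLadder_ladderX hwv, hψinc, hsθ]
      simp [hw]
  rw [← hmap]
  exact kernelZero_raise_lower_fg.map ψ

end IsFundamentalPair

end Equivariant

end FundPair

theorem mainTheorem1 {k B : Type*} [Field k] [CharZero k] [CommRing B] [IsDomain B]
    [Algebra k B] [Algebra.FiniteType k B] (D U : Derivation k B B)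
    (hpair : FundPair.IsFundamentalPair D U) (hnt : FundPair.IsNontrivialPair D U) :
    -- (a) `A = ker D` is affine
    Algebra.FiniteType k (FundPair.kernel D) ∧
    -- (b) `A` is graded by the `A_i`, `i ∈ ℕ`, and `I_n` is the sum of the `A_i` with `i ≥ n`
    ((∀ n : ℕ, (FundPair.imageIdeal D n).restrictScalars k =
        ⨆ i : ℕ, ⨆ _ : n ≤ i, FundPair.kernelPiece D U i) ∧
      (∀ d : ℤ, d < 0 → FundPair.kernelPiece D U d = ⊥) ∧
      SetLike.GradedMonoid (fun i : ℕ => FundPair.kernelPiece D U i) ∧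
      DirectSum.IsInternal (fun i : ℕ => FundPair.kernelPiece D U i)) ∧
    -- (c) homogeneous generators of `I_1`; `m` is their maximal degree
    (∀ (r : ℕ) (f : Fin r → FundPair.kernel D),
      (∀ i, ∃ d : ℤ, f i ∈ FundPair.kernelPiece D U d) →
      FundPair.imageIdeal D 1 = Ideal.span (Set.range f) →
      ∃ m : ℕ,
        IsGreatest {d : ℤ | ∃ i, f i ≠ 0 ∧ f i ∈ FundPair.kernelPiece D U d} (m : ℤ) ∧
        -- (i)
        (Algebra.adjoin (FundPair.kernelZero D U)
          (Set.range fun i => (f i : B))).restrictScalars k = FundPair.kernel D ∧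
        -- (ii)
        (∀ n : ℕ, 1 ≤ n → FundPair.imageIdeal D n =
          Ideal.span (⋃ i ∈ Set.Ico n (n + m),
            (FundPair.kernelPiece D U (i : ℤ) : Set (FundPair.kernel D)))) ∧
        -- (iii)
        (∀ n : ℕ, m < n → FundPair.imageIdeal D n =
          ⨆ e ∈ {e : Fin m → ℕ | ∑ i : Fin m, ((i : ℕ) + 1) * e i = n},
            ∏ i : Fin m, FundPair.imageIdeal D ((i : ℕ) + 1) ^ e i)) ∧
    -- (d)
    (∀ n : ℕ, 1 ≤ n → ∀ (s : ℕ) (g : Fin s → FundPair.kernel D),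
      (∀ i, ∃ d : ℤ, g i ∈ FundPair.kernelPiece D U d) →
      FundPair.imageIdeal D n = Ideal.span (Set.range g) →
      FundPair.degreeModule D n =
        Submodule.span (FundPair.kernel D) (Set.range fun i => U^[n] (g i : B)) ⊔
          FundPair.degreeModule D (n - 1)) ∧
    -- (e)
    (FundPair.IsDirectSumOver (FundPair.kernelZero D U) (Set.univ : Set B)
        (FundPair.kernel U : Set B) (Set.range D) ∧
      FundPair.IsDirectSumOver (FundPair.kernelZero D U) (Set.univ : Set B)
        (FundPair.kernel D : Set B) (Set.range U)) ∧
    -- (f)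
    ((∀ n : ℤ, Set.MapsTo D (FundPair.piece D U n) (FundPair.piece D U (n + 2))) ∧
      (∀ n : ℤ, n ≤ -1 → Set.InjOn D (FundPair.piece D U n)) ∧
      (∀ n : ℤ, -1 ≤ n →
        Set.SurjOn D (FundPair.piece D U n) (FundPair.piece D U (n + 2)))) ∧
    -- (g)
    (D '' (FundPair.piece D U (-2) : Set B) = U '' (FundPair.piece D U 2 : Set B) ∧
      FundPair.IsDirectSumOver (FundPair.kernelZero D U) (FundPair.piece D U 0 : Set B)
        (FundPair.kernelZero D U : Set B) (D '' (FundPair.piece D U (-2) : Set B))) := by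
  refine ⟨(FundPair.kernel D).fg_iff_finiteType.1 hpair.kernel_fg,
    ⟨hpair.imageIdeal_eq_iSup, fun d => hpair.kernelPiece_of_neg,
      FundPair.IsFundamentalPair.gradedMonoid_kernelPiece, hpair.isInternal_kernelPiece⟩,
    ?_, ?_, ⟨?_, ?_⟩, ⟨fun n b => hpair.map_left_mem, fun n => hpair.left_injOn,
      fun n => hpair.left_surjOn⟩, hpair.image_left_eq_image_right,
    hpair.isDirectSumOver_piece_zero⟩
  · intro r f hf hI
    choose e he using hf
    obtain ⟨m, hm⟩ := hpair.exists_isGreatest_degree hnt he hI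
    have hle : ∀ i, f i ≠ 0 → e i ≤ m := fun i hi => hm.2 ⟨i, hi, he i⟩
    exact ⟨m, hm, hpair.adjoin_kernelZero_eq he hI,
      fun n hn => hpair.imageIdeal_eq_span_Ico he hI hle hn,
      fun n _ => hpair.imageIdeal_eq_weightedProduct he hI hle n⟩
  · intro n hn s g hg hI
    choose e he using hg
    exact hpair.degreeModule_eq_span_sup hn he hI
  -- `B = Ω ⊕ D B` is the mirror image of `B = A ⊕ U B`, over the same ring `A_0`, which is killed
  -- by both derivations.
  · exact hpair.symm.isDirectSumOver_univ _ hpair.kernelZero_le_kernel_right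
      FundPair.kernelZero_le_kernel_left
  · exact hpair.isDirectSumOver_univ _ FundPair.kernelZero_le_kernel_left
      hpair.kernelZero_le_kernel_right
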